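/- Let $P_Z$ be a probability distribution on $\mathcal Z$, let $N\ge 1$, and consider the randomized subsample setting: $\tilde S=(\tilde Z_1,\dots,\tilde Z_{2N})$ consists of $2N$ i.i.d. samples from $P_Z$, $U=(U_1,\dots,U_N)$ of $N$ i.i.d. Bernoulli$(1/2)$ bits, and the dataset is $S=(Z_1,\dots,Z_N)$ with $Z_i=\tilde Z_{i+U_iN}$. Let $\{W_\theta:\theta\in\mathbb R^d\}\subseteq\mathcal W$ be a parametrized family of hypotheses and let $\ell:\mathcal W\times\mathcal Z\to[a,b]$ be a loss such that, for every $z$, the function $\theta\mapsto\ell(W_\theta,z)$ is differentiable and $L$-Lipschitz for the Euclidean norm. Write $\operatorname{gen}(w,S)=\mathbb E_{Z\sim P_Z}[\ell(w,Z)]-\frac1N\sum_{i=1}^N\ell(w,Z_i)$. Stochastic gradient Langevin dynamics (SGLD) starts from a random parameter $\theta_0$ and, for $t=1,\dots,T$, sets $$\theta_t=\theta_{t-1}-\eta_t\nabla_\theta\Big(\frac1{|V_t|}\sum_{i\in V_t}\ell(W_{\theta},Z_i)\Big)\Big|_{\theta=\theta_{t-1}}+\sigma_t\varepsilon_t,$$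 where $\eta_t\in\mathbb R$ and $\sigma_t>0$ are deterministic, the $\varepsilon_t\sim\mathcal N(0,I_d)$ are i.i.d., and $V^T=(V_1,\dots,V_T)$ is a random sequence of batches $V_t\subseteq\{1,\dots,N\}$ with an arbitrary law. Assume that $|V_t|=K$ almost surely for every $t$, for a constant $K\ge1$. Let $J$ be uniformly distributed on $\{1,\dots,N\}$, and let $J$, $\tilde S$, $U$, $V^T$, $\theta_0$, $(\varepsilon_t)_{t\le T}$ be mutually independent. Let $W_t=W_{\theta_t}$ and $W=W_T$; a hypothesis is identified with its parameter, so $W^{t-1}$ stands for $(\theta_0,\dots,\theta_{t-1})$. For every $t$, let $\pi_{J,t}\in[0,1]$ be any estimate of the probability that $U_J=1$ that is a measurable function of $J$, $\tilde S$, $U_{J^c}=(U_i)_{i\ne J}$, the batches $V^T$ and the trajectory $W^{t-1}$. Then $$\mathbb E\big[\operatorname{gen}(W,S)\big]\le\frac{2L}{K}(b-a)\,\mathbb E_{P_1}\left[\sqrt{\sum_{t\in\mathcal T_J(V^T)}\mathbb E_{P_2^t}\left[\frac{\eta_t^2}{\sigma_t^2}(U_J-\pi_{J,t})^2\right]}\right],$$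 where $\mathcal T_J(V^T)=\{t: J\in V_t\}$, $P_1$ is the joint law of $(J,\tilde S,U,V^T)$, and $P_2^t$ is the conditional law of $W^{t-1}$ given $(U,\tilde S,V^{t-1})$, with $V^{t-1}=(V_1,\dots,V_{t-1})$. -/

import Mathlib

open MeasureTheory ProbabilityTheory

noncomputable section

/-- The parameter space `ℝ^d` with its Euclidean norm. -/
abbrev Param (d : ℕ) : Type := EuclideanSpace ℝ (Fin d)

/-- A super-sample of `2N` points. The index `(u, i)` stands for the position `i + u N`. -/
abbrev SuperSample (N : ℕ) (𝒵 : Type*) : Type _ := Fin 2 × Fin N → 𝒵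

/-- The dataset selected from the super-sample by the bits `u`: `Z_i = Z̃_{i + u_i N}`. -/
def dataset {N : ℕ} {𝒵 : Type*} (s : SuperSample N 𝒵) (u : Fin N → Fin 2) : Fin N → 𝒵 :=
  fun i => s (u i, i)

/-- The empirical risk of the hypothesis `w` on the points of the dataset `z` indexed by `B`. -/
def empiricalRisk {N : ℕ} {𝒲 𝒵 : Type*} (ℓ : 𝒲 → 𝒵 → ℝ) (z : Fin N → 𝒵)
    (B : Finset (Fin N)) (w : 𝒲) : ℝ :=
  (1 / (B.card : ℝ)) * ∑ i ∈ B, ℓ w (z i)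

/-- The population risk of the hypothesis `w`. -/
def populationRisk {𝒲 𝒵 : Type*} [MeasurableSpace 𝒵] (ℓ : 𝒲 → 𝒵 → ℝ) (PZ : Measure 𝒵)
    (w : 𝒲) : ℝ :=
  ∫ z, ℓ w z ∂PZ

/-- The generalization error of the hypothesis `w` for the dataset `z`: population risk minus
empirical risk on the whole dataset. -/
def genError {N : ℕ} {𝒲 𝒵 : Type*} [MeasurableSpace 𝒵] (ℓ : 𝒲 → 𝒵 → ℝ) (PZ : Measure 𝒵)
    (w : 𝒲) (z : Fin N → 𝒵) : ℝ :=
  populationRisk ℓ PZ w - empiricalRisk ℓ z Finset.univ w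

/-- One iteration of stochastic gradient Langevin dynamics from the parameter `θ`, with batch `B` of
the dataset `z`, learning rate `η`, noise level `σ` and noise `ε`, for the hypotheses `hyp θ`. -/
def sgldStep {N d : ℕ} {𝒲 𝒵 : Type*} (ℓ : 𝒲 → 𝒵 → ℝ) (hyp : Param d → 𝒲) (z : Fin N → 𝒵)
    (B : Finset (Fin N)) (η σ : ℝ) (θ ε : Param d) : Param d :=
  θ - η • gradient (fun θ' => empiricalRisk ℓ z B (hyp θ')) θ + σ • ε

/-- The set of iterations whose batch contains the index `j`. -/
def itersWith {N T : ℕ} (v : Fin T → Finset (Fin N)) (j : Fin N) : Finset (Fin T) :=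
  Finset.univ.filter fun t => j ∈ v t

/-- The bits `u` at all positions other than `j`. -/
def bitsExcept {N : ℕ} (u : Fin N → Fin 2) (j : Fin N) : {i : Fin N // i ≠ j} → Fin 2 :=
  fun i => u i

/-- The parameters available before the update number `t` (counting from `0`): `θ 0, …, θ t`. -/
def paramsUpTo {T : ℕ} {E : Type*} (θ : Fin (T + 1) → E) (t : Fin T) : Fin (t.val + 1) → E :=
  fun s => θ ⟨s.val, lt_of_lt_of_le s.isLt (Nat.succ_le_succ t.isLt.le)⟩

/-- The batches used before the update number `t` (counting from `0`). -/
def batchesBefore {T : ℕ} {B : Type*} (v : Fin T → B) (t : Fin T) : Fin t.val → B :=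
  fun s => v ⟨s.val, s.isLt.trans t.isLt⟩

/-- The regular conditional distribution of the trajectory of parameters before the update number
`t`, given the bits, the super-sample and the batches used before that update. -/
def trajectoryLaw {Ω 𝒵 : Type*} [MeasurableSpace Ω] [MeasurableSpace 𝒵] {N d T : ℕ}
    (μ : Measure Ω) [IsFiniteMeasure μ] (S : Ω → SuperSample N 𝒵) (U : Ω → Fin N → Fin 2)
    (V : Ω → Fin T → Finset (Fin N)) (θ : Fin (T + 1) → Ω → Param d) (t : Fin T) :
    Kernel ((Fin N → Fin 2) × SuperSample N 𝒵 × (Fin t.val → Finset (Fin N)))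
      (Fin (t.val + 1) → Param d) :=
  condDistrib (fun ω => paramsUpTo (fun s => θ s ω) t)
    (fun ω => (U ω, S ω, batchesBefore (V ω) t)) μ

end

/-!
Fix the super-sample, the batches and the bits other than the one at `j`. The two values of the bit
at `j` give two runs of the algorithm, whose drifts differ only at the updates that involve `j`.
Compare each of them with a reference run whose drift mixes the two gradient steps with weights
`1 - π` and `π`: it is the same run driven by Gaussian noise displaced by a predictable amount of
size at most `2 L |η| / (K σ) * |U_j - π|`. Shifting the noise costs half the squared displacement
in a Gaussian entropic inequality, so Hoeffding's lemma bounds the difference of the means of a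
function `|F| ≤ M` of the final parameter by `M` times the root of the total mean squared
displacement. For the difference `F` of the losses at the two points of index `j`, the two reference
terms cancel, because the sign of the loss gap follows the bit. Since the run does not see the
unselected point at `j`, the mean loss gap, averaged over `j`, is the mean generalization error.
-/

noncomputable section

section BoundedFunctions

variable {α : Type*} [MeasurableSpace α] {μ : Measure α} {f : α → ℝ} {C : ℝ}

theorem integrable_of_abs_le [IsFiniteMeasure μ] (hf : Measurable f) (hC : ∀ x, |f x| ≤ C) :
    Integrable f μ :=
  .of_bound hf.aestronglyMeasurable C (ae_of_all _ hC)

theorem integrable_exp_of_abs_le [IsFiniteMeasure μ] (hf : Measurable f) (hC : ∀ x, |f x| ≤ C) :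
    Integrable (fun x => Real.exp (f x)) μ :=
  integrable_of_abs_le hf.exp (C := Real.exp C) fun x => by
    simpa using (abs_le.1 (hC x)).2

variable [IsProbabilityMeasure μ]

theorem abs_integral_le_of_abs_le (hC : ∀ x, |f x| ≤ C) : |∫ x, f x ∂μ| ≤ C := by
  simpa using norm_integral_le_of_norm_le_const (μ := μ) (f := f) (ae_of_all _ hC)

theorem integral_le_log_integral_exp (hf : Integrable f μ)
    (hexp : Integrable (fun x => Real.exp (f x)) μ) :
    ∫ x, f x ∂μ ≤ Real.log (∫ x, Real.exp (f x) ∂μ) :=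
  (Real.le_log_iff_exp_le (integral_exp_pos hexp)).2 <|
    convexOn_exp.map_integral_le Real.continuous_exp.continuousOn isClosed_univ
      (ae_of_all _ fun _ => trivial) hf hexp

theorem abs_log_integral_exp_le (hf : Measurable f) (hC : ∀ x, |f x| ≤ C) :
    |Real.log (∫ x, Real.exp (f x) ∂μ)| ≤ C := by
  have hint : Integrable (fun x => Real.exp (f x)) μ := integrable_exp_of_abs_le hf hC
  have hpos := integral_exp_pos hint
  rw [abs_le, Real.le_log_iff_exp_le hpos, Real.log_le_iff_le_exp hpos]
  constructor
  · simpa using integral_mono (integrable_const (Real.exp (-C))) hint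
      fun x => Real.exp_le_exp.2 (abs_le.1 (hC x)).1
  · simpa using integral_mono hint (integrable_const (Real.exp C))
      fun x => Real.exp_le_exp.2 (abs_le.1 (hC x)).2

theorem cgf_le_of_abs_le (hf : Measurable f) (hC : ∀ x, |f x| ≤ C) (r : ℝ) :
    cgf f μ r ≤ r * ∫ x, f x ∂μ + r ^ 2 * C ^ 2 / 2 := by
  have hoeffding := (hasSubgaussianMGF_of_mem_Icc (μ := μ) hf.aemeasurable
    (ae_of_all _ fun x => abs_le.1 (hC x))).cgf_le r
  have hconst : (((‖C - -C‖₊ / 2) ^ 2 : NNReal) : ℝ) = C ^ 2 := by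
    push_cast
    rw [div_pow, Real.norm_eq_abs, sq_abs]
    ring
  have hpos : 0 < mgf f μ r := integral_exp_pos <|
    integrable_exp_of_abs_le (hf.const_mul r) (C := |r| * C) fun x => by
      rw [abs_mul]
      gcongr
      exact hC x
  simp only [cgf, sub_eq_add_neg, mgf_add_const] at hoeffding ⊢
  rw [Real.log_mul hpos.ne' (Real.exp_ne_zero _), Real.log_exp, ← sub_eq_add_neg, hconst]
    at hoeffding
  linarith

end BoundedFunctions

/-- The entropic shift inequality with cost `q`: translating the argument of `Ψ` by `a` costs at
most `q a / 2` in the comparison of the mean with the logarithmic moment generating function. -/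
def EntropicShift {E : Type*} [Add E] [MeasurableSpace E] (γ : Measure E) (q : E → ℝ) : Prop :=
  ∀ (a : E) (Ψ : E → ℝ) (C : ℝ), Measurable Ψ → (∀ x, |Ψ x| ≤ C) →
    ∫ x, Ψ (x + a) ∂γ - q a / 2 ≤ Real.log (∫ x, Real.exp (Ψ x) ∂γ)

theorem integral_gaussianReal_eq_integral_add (g : ℝ → ℝ) (a : ℝ) :
    ∫ x, g x ∂(gaussianReal 0 1) =
      ∫ x, Real.exp (-a * x - a ^ 2 / 2) * g (x + a) ∂(gaussianReal 0 1) := by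
  rw [integral_gaussianReal_eq_integral_smul one_ne_zero,
    integral_gaussianReal_eq_integral_smul one_ne_zero, ← integral_add_right_eq_self _ a]
  congr 1 with x
  simp only [gaussianPDFReal, smul_eq_mul, NNReal.coe_one, mul_one, sub_zero]
  rw [mul_assoc, mul_assoc, ← mul_assoc (Real.exp _) (Real.exp _), ← Real.exp_add]
  ring_nf

theorem entropicShift_gaussianReal : EntropicShift (gaussianReal 0 1) (fun x => x ^ 2) := by
  intro a Ψ C hΨ hC
  have hshift : Measurable fun x => Ψ (x + a) := hΨ.comp (measurable_add_const a)
  have hid : Integrable (fun x : ℝ => -a * x) (gaussianReal 0 1) :=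
    (memLp_one_iff_integrable.1 (memLp_id_gaussianReal' 1 (by simp))).const_mul _
  have hlin : Integrable (fun x : ℝ => -a * x - a ^ 2 / 2) (gaussianReal 0 1) :=
    hid.sub (integrable_const _)
  have hΨi : Integrable (fun x => Ψ (x + a)) (gaussianReal 0 1) :=
    integrable_of_abs_le hshift fun x => hC _
  have hexp : Integrable (fun x => Real.exp (-a * x - a ^ 2 / 2 + Ψ (x + a)))
      (gaussianReal 0 1) := by
    simp only [Real.exp_add, sub_eq_add_neg]
    refine ((integrable_exp_mul_gaussianReal (-a)).mul_const _).mul_bdd (c := Real.exp C)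
      hshift.exp.aestronglyMeasurable (ae_of_all _ fun x => ?_)
    simpa using (abs_le.1 (hC (x + a))).2
  have hjensen := integral_le_log_integral_exp (hlin.add hΨi) hexp
  simp only [Pi.add_apply, Real.exp_add] at hjensen
  rw [← integral_gaussianReal_eq_integral_add (fun x => Real.exp (Ψ x)),
    integral_add hlin hΨi, integral_sub hid (integrable_const _), integral_const_mul,
    integral_id_gaussianReal] at hjensen
  simp only [integral_const, probReal_univ, one_smul] at hjensen
  linarith

section FinCons

variable {E : Type*} [MeasurableSpace E] {n : ℕ}

@[fun_prop]
theorem measurable_finCons :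
    Measurable fun p : E × (Fin n → E) => (Fin.cons p.1 p.2 : Fin (n + 1) → E) :=
  measurable_pi_lambda _ <| Fin.cases measurable_fst fun i =>
    (measurable_pi_apply i).comp measurable_snd

theorem measurePreserving_finCons (γ : Measure E) [SigmaFinite γ] :
    MeasurePreserving (fun p : E × (Fin n → E) => (Fin.cons p.1 p.2 : Fin (n + 1) → E))
      (γ.prod (Measure.pi fun _ => γ)) (Measure.pi fun _ => γ) := by
  simpa [MeasurableEquiv.piFinSuccAbove_symm_apply, Fin.insertNthEquiv] using
    (measurePreserving_piFinSuccAbove (fun _ : Fin (n + 1) => γ) 0).symm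

theorem integral_pi_finCons (γ : Measure E) [SigmaFinite γ] {F : (Fin (n + 1) → E) → ℝ}
    (hF : Measurable F) :
    ∫ x, F x ∂(Measure.pi fun _ => γ) =
      ∫ p : E × (Fin n → E), F (Fin.cons p.1 p.2) ∂(γ.prod (Measure.pi fun _ => γ)) := by
  rw [← (measurePreserving_finCons γ).map_eq,
    integral_map measurable_finCons.aemeasurable hF.aestronglyMeasurable]

end FinCons

namespace EntropicShift

variable {E : Type*} [Add E] [MeasurableSpace E] [MeasurableAdd₂ E] {γ : Measure E} {q : E → ℝ}

theorem integral_sub_le_log_integral_prod {F : Type*} [MeasurableSpace F] {κ : Measure F}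
    [IsProbabilityMeasure γ] [IsProbabilityMeasure κ] (hγ : EntropicShift γ q) {G : E × F → ℝ}
    (hG : Measurable G) {C : ℝ} (hC : ∀ p, |G p| ≤ C) (a : E) {H : E → ℝ} (hH : Integrable H γ)
    (hle : ∀ x, H x ≤ Real.log (∫ y, Real.exp (G (x + a, y)) ∂κ)) :
    ∫ x, H x ∂γ - q a / 2 ≤ Real.log (∫ p, Real.exp (G p) ∂(γ.prod κ)) := by
  let Ψ : E → ℝ := fun x => Real.log (∫ y, Real.exp (G (x, y)) ∂κ)
  have hsection (x : E) : Measurable fun y => G (x, y) := hG.comp measurable_prodMk_left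
  have hΨ : Measurable Ψ :=
    Real.measurable_log.comp hG.exp.stronglyMeasurable.integral_prod_right.measurable
  have hΨC (x : E) : |Ψ x| ≤ C := abs_log_integral_exp_le (hsection x) fun y => hC _
  have hexp : ∫ p, Real.exp (G p) ∂(γ.prod κ) = ∫ x, Real.exp (Ψ x) ∂γ := by
    rw [integral_prod _ (integrable_exp_of_abs_le hG hC)]
    exact integral_congr_ae (ae_of_all _ fun x => (Real.exp_log <| integral_exp_pos <|
      integrable_exp_of_abs_le (hsection x) fun y => hC _).symm)
  have hmono : ∫ x, H x ∂γ ≤ ∫ x, Ψ (x + a) ∂γ :=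
    integral_mono hH (integrable_of_abs_le (hΨ.comp (measurable_add_const a)) fun x => hΨC _) hle
  rw [hexp]
  linarith [hγ a Ψ C hΨ hΨC]

end EntropicShift

/-- A shift of the vectors `x : Fin n → E` that is predictable: the `t`-th coordinate `a x t` is a
function of the coordinates of `x` of index less than `t` only. -/
structure IsPredictable {E : Type*} [MeasurableSpace E] {n : ℕ}
    (a : (Fin n → E) → Fin n → E) : Prop where
  measurable : Measurable a
  dependsOn : ∀ t, DependsOn (fun x => a x t) (Set.Iio t)

namespace IsPredictable

variable {E : Type*} [MeasurableSpace E] {n : ℕ}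

theorem apply_zero_eq {a : (Fin (n + 1) → E) → Fin (n + 1) → E} (ha : IsPredictable a)
    (x y : Fin (n + 1) → E) : a x 0 = a y 0 :=
  ha.dependsOn 0 fun s hs => absurd hs (Fin.not_lt_zero s)

theorem tail {a : (Fin (n + 1) → E) → Fin (n + 1) → E} (ha : IsPredictable a) (x : E) :
    IsPredictable fun y : Fin n → E => Fin.tail (a (Fin.cons x y)) where
  measurable := measurable_pi_lambda _ fun t => (measurable_pi_apply t.succ).comp <|
    ha.measurable.comp <| measurable_finCons.comp measurable_prodMk_left
  dependsOn t y z hyz := ha.dependsOn t.succ <| Fin.cases (fun _ => rfl) fun s hs => by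
    simpa using hyz s (Fin.succ_lt_succ_iff.1 hs)

end IsPredictable

/-- The value at `x` of the function `G` translated by the predictable shift `a`, penalised by half
of the cost `q` of every coordinate of the shift. -/
def penalizedShift {E : Type*} [Add E] (q : E → ℝ) {n : ℕ} (a : (Fin n → E) → Fin n → E)
    (G : (Fin n → E) → ℝ) (x : Fin n → E) : ℝ :=
  G (x + a x) - (∑ t, q (a x t)) / 2

section PenalizedShift

variable {E : Type*} [Add E] {q : E → ℝ} {n : ℕ} {a : (Fin n → E) → Fin n → E}
  {G : (Fin n → E) → ℝ}

theorem measurable_penalizedShift [MeasurableSpace E] [MeasurableAdd₂ E] (hq : Measurable q)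
    (ha : Measurable a) (hG : Measurable G) : Measurable (penalizedShift q a G) := by
  unfold penalizedShift
  fun_prop

theorem abs_penalizedShift_le {C D : ℝ} (hC : ∀ x, |G x| ≤ C) (hD : ∀ x t, |q (a x t)| ≤ D)
    (x : Fin n → E) : |penalizedShift q a G x| ≤ C + n * D / 2 := by
  have hcost : |∑ t, q (a x t)| ≤ n * D := by
    simpa using (Finset.abs_sum_le_sum_abs _ _).trans
      (Finset.sum_le_sum fun t (_ : t ∈ Finset.univ) => hD x t)
  have htriangle := abs_sub (G (x + a x)) ((∑ t, q (a x t)) / 2)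
  rw [abs_div, abs_two] at htriangle
  unfold penalizedShift
  linarith [hC (x + a x)]

theorem penalizedShift_finCons {a : (Fin (n + 1) → E) → Fin (n + 1) → E}
    {G : (Fin (n + 1) → E) → ℝ} (x : E) (y : Fin n → E) :
    penalizedShift q a G (Fin.cons x y) =
      penalizedShift q (fun y => Fin.tail (a (Fin.cons x y)))
        (fun y' => G (Fin.cons (x + a (Fin.cons x y) 0) y')) y - q (a (Fin.cons x y) 0) / 2 := by
  have hcons : (Fin.cons x y : Fin (n + 1) → E) + a (Fin.cons x y) =
      Fin.cons (x + a (Fin.cons x y) 0) (y + Fin.tail (a (Fin.cons x y))) :=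
    funext <| Fin.cases (by simp) fun t => by simp [Fin.tail]
  simp only [penalizedShift, hcons, Fin.sum_univ_succ, Fin.tail]
  ring

end PenalizedShift

namespace EntropicShift

variable {E : Type*} [Add E] [MeasurableSpace E] [MeasurableAdd₂ E] {γ : Measure E}
  [IsProbabilityMeasure γ] {q : E → ℝ}

theorem integral_penalizedShift_le (hγ : EntropicShift γ q) (hq : Measurable q) {n : ℕ}
    {a : (Fin n → E) → Fin n → E} (ha : IsPredictable a) {D : ℝ} (hD : ∀ x t, |q (a x t)| ≤ D)
    {G : (Fin n → E) → ℝ} (hG : Measurable G) {C : ℝ} (hC : ∀ x, |G x| ≤ C) :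
    ∫ x, penalizedShift q a G x ∂(Measure.pi fun _ => γ) ≤
      Real.log (∫ x, Real.exp (G x) ∂(Measure.pi fun _ => γ)) := by
  induction n with
  | zero =>
    have hconst (x : Fin 0 → E) : G x = G Fin.elim0 := congrArg G (Subsingleton.elim _ _)
    simp [penalizedShift, hconst]
  | succ n ih =>
    obtain ⟨x₀⟩ : Nonempty E := nonempty_of_isProbabilityMeasure γ
    let a₀ : E := a (fun _ => x₀) 0
    let tailValue (p : E × (Fin n → E)) : ℝ := penalizedShift q
      (fun y => Fin.tail (a (Fin.cons p.1 y))) (fun y => G (Fin.cons (p.1 + a₀) y)) p.2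
    have hfull (x y) : penalizedShift q a G (Fin.cons x y) = tailValue (x, y) - q a₀ / 2 := by
      rw [penalizedShift_finCons, ha.apply_zero_eq (Fin.cons x y) fun _ => x₀]
    have hmeas := measurable_penalizedShift hq ha.measurable hG
    have htail : Integrable tailValue (γ.prod (Measure.pi fun _ => γ)) := by
      refine integrable_of_abs_le ?_ fun p => abs_penalizedShift_le (fun _ => hC _)
        (fun _ _ => hD _ _) p.2
      simpa [hfull] using (hmeas.comp measurable_finCons).add_const (q a₀ / 2)
    have hGcons : Measurable fun p : E × (Fin n → E) => G (Fin.cons p.1 p.2) :=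
      hG.comp measurable_finCons
    have hih (x : E) : ∫ y, tailValue (x, y) ∂(Measure.pi fun _ => γ) ≤
        Real.log (∫ y, Real.exp (G (Fin.cons (x + a₀) y)) ∂(Measure.pi fun _ => γ)) :=
      ih (G := fun y => G (Fin.cons (x + a₀) y)) (ha.tail x) (fun _ _ => hD _ _)
        (hGcons.comp measurable_prodMk_left) fun _ => hC _
    rw [integral_pi_finCons γ hmeas, integral_pi_finCons γ hG.exp]
    simp only [hfull]
    rw [integral_sub htail (integrable_const _), integral_prod _ htail]
    simpa using hγ.integral_sub_le_log_integral_prod hGcons (fun _ => hC _) a₀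
      htail.integral_prod_left hih

end EntropicShift

theorem entropicShift_stdGaussian (d : ℕ) :
    EntropicShift (stdGaussian (Param d)) (fun x => ‖x‖ ^ 2) := by
  intro a Ψ C hΨ hC
  have htoLp : Measurable (WithLp.toLp 2 : (Fin d → ℝ) → Param d) := WithLp.measurable_toLp 2 _
  have hshift : Measurable fun x => Ψ (x + a) := hΨ.comp (measurable_add_const a)
  have hcost (i : Fin d) : |a i ^ 2| ≤ ∑ j, a j ^ 2 := by
    rw [abs_of_nonneg (sq_nonneg _)]
    exact Finset.single_le_sum (f := fun j => a j ^ 2) (fun j _ => sq_nonneg _) (Finset.mem_univ i)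
  have hprod := entropicShift_gaussianReal.integral_penalizedShift_le (by fun_prop)
    (a := fun _ : Fin d → ℝ => WithLp.ofLp a)
    ⟨measurable_const, fun t => (dependsOn_const (a t)).mono (Set.empty_subset _)⟩
    (fun _ => hcost) (hΨ.comp htoLp) fun x => hC _
  have hint : Integrable (fun x => Ψ (WithLp.toLp 2 x + a))
      (Measure.pi fun _ : Fin d => gaussianReal 0 1) :=
    integrable_of_abs_le (hshift.comp htoLp) fun x => hC _
  have hpenalized : ∫ x, penalizedShift (fun x => x ^ 2) (fun _ => WithLp.ofLp a)
      (fun x => Ψ (WithLp.toLp 2 x)) x ∂(Measure.pi fun _ : Fin d => gaussianReal 0 1) =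
      ∫ x, Ψ (WithLp.toLp 2 x + a) ∂(Measure.pi fun _ => gaussianReal 0 1) - ‖a‖ ^ 2 / 2 := by
    simp only [penalizedShift, WithLp.toLp_add, WithLp.toLp_ofLp]
    rw [integral_sub hint (integrable_const _)]
    simp [EuclideanSpace.real_norm_sq_eq]
  rw [← map_pi_eq_stdGaussian, integral_map htoLp.aemeasurable hΨ.exp.aestronglyMeasurable,
    integral_map htoLp.aemeasurable hshift.aestronglyMeasurable, ← hpenalized]
  exact hprod

theorem le_mul_sqrt_of_forall_mul_le {X A M : ℝ} (hM : 0 ≤ M) (hA : 0 ≤ A)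
    (h : ∀ r, 0 < r → r * X ≤ A / 2 + r ^ 2 * M ^ 2 / 2) : X ≤ M * Real.sqrt A := by
  refine le_of_forall_pos_le_add fun δ hδ => ?_
  have hs := Real.sqrt_nonneg A
  rw [← Real.sq_sqrt hA] at h
  generalize Real.sqrt A = s at *
  let e : ℝ := δ / (s + M + 1)
  have he : 0 < e := by positivity
  have hδe : e * (s + M + 1) = δ := div_mul_cancel₀ _ (by positivity)
  -- `r = s / M` is optimal; adding `e` avoids the degenerate cases `s = 0` and `M = 0`.
  have hr := h ((s + e) / (M + e)) (by positivity)
  have hX : X ≤ (s ^ 2 * ((M + e) / (s + e)) + M ^ 2 * ((s + e) / (M + e))) / 2 := by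
    field_simp at hr ⊢
    linarith
  have hleft : s ^ 2 * ((M + e) / (s + e)) ≤ s * (M + e) := by
    rw [mul_div_assoc', div_le_iff₀ (by positivity)]
    nlinarith [mul_nonneg (mul_nonneg hs he.le) (add_nonneg hM he.le)]
  have hright : M ^ 2 * ((s + e) / (M + e)) ≤ M * (s + e) := by
    rw [mul_div_assoc', div_le_iff₀ (by positivity)]
    nlinarith [mul_nonneg (mul_nonneg hM he.le) (add_nonneg hs he.le)]
  linarith

theorem integral_prod_le_mul_add {α β : Type*} [MeasurableSpace α] [MeasurableSpace β]
    {μ : Measure α} [IsProbabilityMeasure μ] {ν : Measure β} [SFinite ν] {f g : α × β → ℝ}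
    (hf : Integrable f (μ.prod ν)) (hg : Integrable g (μ.prod ν)) {r c : ℝ}
    (h : ∀ x, ∫ y, f (x, y) ∂ν ≤ r * ∫ y, g (x, y) ∂ν + c) :
    ∫ p, f p ∂(μ.prod ν) ≤ r * ∫ p, g p ∂(μ.prod ν) + c := by
  have hgi := hg.integral_prod_left.const_mul r
  calc ∫ p, f p ∂(μ.prod ν) = ∫ x, ∫ y, f (x, y) ∂ν ∂μ := integral_prod f hf
    _ ≤ ∫ x, (r * ∫ y, g (x, y) ∂ν + c) ∂μ :=
      integral_mono hf.integral_prod_left (hgi.add (integrable_const c)) h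
    _ = r * ∫ p, g p ∂(μ.prod ν) + c := by
      rw [integral_add hgi (integrable_const c), integral_const_mul, ← integral_prod g hg]
      simp

namespace EntropicShift

variable {E E₀ : Type*} [Add E] [MeasurableSpace E] [MeasurableAdd₂ E] [MeasurableSpace E₀]
  {γ : Measure E} [IsProbabilityMeasure γ] {q : E → ℝ} {n : ℕ} {D M : ℝ}

theorem integral_penalizedShift_mul_le (hγ : EntropicShift γ q) (hq : Measurable q)
    {a : (Fin n → E) → Fin n → E} (ha : IsPredictable a) (hD : ∀ x t, |q (a x t)| ≤ D)
    {G : (Fin n → E) → ℝ} (hG : Measurable G) (hM : ∀ x, |G x| ≤ M) (r : ℝ) :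
    ∫ x, penalizedShift q a (fun x => r * G x) x ∂(Measure.pi fun _ => γ) ≤
      r * ∫ x, G x ∂(Measure.pi fun _ => γ) + r ^ 2 * M ^ 2 / 2 := by
  refine (hγ.integral_penalizedShift_le hq ha hD (hG.const_mul r) (C := |r| * M)
    fun x => ?_).trans (cgf_le_of_abs_le hG hM r)
  rw [abs_mul]
  gcongr
  exact hM x

theorem integral_shift_sub_le (hγ : EntropicShift γ q) (hq : Measurable q) (hq0 : ∀ x, 0 ≤ q x)
    (ν : Measure E₀) [IsProbabilityMeasure ν] {a : E₀ → (Fin n → E) → Fin n → E}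
    (ha : Measurable fun p : E₀ × (Fin n → E) => a p.1 p.2) (hpred : ∀ w, IsPredictable (a w))
    (hD : ∀ w x t, q (a w x t) ≤ D)
    {G : E₀ × (Fin n → E) → ℝ} (hG : Measurable G) (hM : ∀ p, |G p| ≤ M) :
    ∫ p, G (p.1, p.2 + a p.1 p.2) ∂(ν.prod (Measure.pi fun _ => γ)) -
        ∫ p, G p ∂(ν.prod (Measure.pi fun _ => γ)) ≤
      M * Real.sqrt (∑ t, ∫ p, q (a p.1 p.2 t) ∂(ν.prod (Measure.pi fun _ => γ))) := by
  set P := ν.prod (Measure.pi fun _ : Fin n => γ)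
  have hDabs (w x t) : |q (a w x t)| ≤ D := by rw [abs_of_nonneg (hq0 _)]; exact hD w x t
  have hM0 : 0 ≤ M := (abs_nonneg _).trans (hM (nonempty_of_isProbabilityMeasure P).some)
  have hGi : Integrable G P := integrable_of_abs_le hG hM
  have hGa : Integrable (fun p => G (p.1, p.2 + a p.1 p.2)) P :=
    integrable_of_abs_le (by fun_prop) fun p => hM _
  have hqa (t) : Integrable (fun p : E₀ × (Fin n → E) => q (a p.1 p.2 t)) P :=
    integrable_of_abs_le (by fun_prop) fun p => hDabs _ _ t
  have hsum : Integrable (fun p : E₀ × (Fin n → E) => ∑ t, q (a p.1 p.2 t)) P :=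
    integrable_finsetSum _ fun t _ => hqa t
  refine le_mul_sqrt_of_forall_mul_le hM0
    (Finset.sum_nonneg fun t _ => integral_nonneg fun p => hq0 _) fun r _ => ?_
  have hpen : Integrable (fun p : E₀ × (Fin n → E) =>
      penalizedShift q (a p.1) (fun x => r * G (p.1, x)) p.2) P :=
    (hGa.const_mul r).sub (hsum.div_const 2)
  have hmean : ∫ p, penalizedShift q (a p.1) (fun x => r * G (p.1, x)) p.2 ∂P ≤
      r * ∫ p, G p ∂P + r ^ 2 * M ^ 2 / 2 :=
    integral_prod_le_mul_add hpen hGi fun w => hγ.integral_penalizedShift_mul_le hq (hpred w)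
      (hDabs w) (hG.comp measurable_prodMk_left) (fun x => hM _) r
  simp only [penalizedShift] at hmean
  rw [integral_sub (hGa.const_mul r) (hsum.div_const 2), integral_const_mul, integral_div,
    integral_finsetSum _ fun t _ => hqa t] at hmean
  linarith

end EntropicShift

section History

variable {A E : Type*} {T : ℕ}

/-- The histories `θ 0, …, θ t` of the recursion `θ (t + 1) = Φ t (θ 0, …, θ t) (e t)` started at
`θ 0 = w` and driven by the noise `e`. -/
def history (Φ : (t : Fin T) → (Fin (t.val + 1) → E) → E → E) (w : E) (e : Fin T → E)
    (t : Fin (T + 1)) : Fin (t.val + 1) → E :=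
  Fin.induction (motive := fun t => Fin (t.val + 1) → E) (fun _ => w)
    (fun t h => Fin.snoc h (Φ t h (e t))) t

variable {Φ Φ' : (t : Fin T) → (Fin (t.val + 1) → E) → E → E} {w : E} {e e' : Fin T → E}

theorem history_succ (t : Fin T) : history Φ w e t.succ =
    Fin.snoc (history Φ w e t.castSucc) (Φ t (history Φ w e t.castSucc) (e t)) :=
  rfl

theorem eq_history {p : Fin (T + 1) → E} (h0 : p 0 = w)
    (hp : ∀ t : Fin T, p t.succ = Φ t (paramsUpTo p t) (e t)) (t : Fin (T + 1)) :
    (fun s : Fin (t.val + 1) => p (s.castLE t.isLt)) = history Φ w e t := by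
  induction t using Fin.induction with
  | zero => exact funext fun s => by rw [Fin.fin_one_eq_zero s]; exact h0
  | succ t ih =>
    have hpast : paramsUpTo p t = history Φ w e t.castSucc := ih
    rw [history_succ, ← hpast, ← hp]
    exact funext <| Fin.lastCases (by rw [Fin.snoc_last]; rfl) fun s => by
      rw [Fin.snoc_castSucc]; rfl

theorem history_congr {t : Fin (T + 1)}
    (h : ∀ s : Fin T, s.castSucc < t →
      Φ s (history Φ w e s.castSucc) (e s) = Φ' s (history Φ w e s.castSucc) (e' s)) :
    history Φ w e t = history Φ' w e' t := by
  induction t using Fin.induction with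
  | zero => rfl
  | succ t ih =>
    rw [history_succ, history_succ, h t t.castSucc_lt_succ,
      ih fun s hs => h s (hs.trans t.castSucc_lt_succ)]

theorem dependsOn_history (t : Fin T) :
    DependsOn (fun e => history Φ w e t.castSucc) (Set.Iio t) := fun e e' hee' =>
  history_congr fun s hs => by rw [hee' s (Fin.castSucc_lt_castSucc_iff.1 hs)]

variable [MeasurableSpace A] [MeasurableSpace E]

theorem measurable_finSnoc {n : ℕ} :
    Measurable fun p : (Fin n → E) × E => (Fin.snoc p.1 p.2 : Fin (n + 1) → E) :=
  measurable_pi_lambda _ <| Fin.lastCases (by simpa using measurable_snd) fun i => by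
    simp only [Fin.snoc_castSucc]
    fun_prop

theorem measurable_history {Φ : A → (t : Fin T) → (Fin (t.val + 1) → E) → E → E}
    (hΦ : ∀ t, Measurable fun p : A × (Fin (t.val + 1) → E) × E => Φ p.1 t p.2.1 p.2.2)
    {w : A → E} (hw : Measurable w) {e : A → Fin T → E} (he : Measurable e) (t : Fin (T + 1)) :
    Measurable fun x => history (Φ x) (w x) (e x) t := by
  induction t using Fin.induction with
  | zero => exact measurable_pi_lambda _ fun _ => hw
  | succ t ih =>
    exact measurable_finSnoc.comp (ih.prodMk ((hΦ t).comp (measurable_id.prodMk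
      (ih.prodMk ((measurable_pi_apply t).comp he)))))

end History

section Langevin

variable {E : Type*} [NormedAddCommGroup E] [NormedSpace ℝ E] {T : ℕ}

/-- The update of a discretised Langevin dynamics: the drift `b t` evaluated at the history, plus
the noise scaled by `σ t`. -/
def langevinUpdate (b : (t : Fin T) → (Fin (t.val + 1) → E) → E) (σ : Fin T → ℝ) (t : Fin T)
    (h : Fin (t.val + 1) → E) (e : E) : E :=
  b t h + σ t • e

variable {b b' : (t : Fin T) → (Fin (t.val + 1) → E) → E} {σ : Fin T → ℝ}

/-- The displacement of the noise that turns the drift `b'` into the drift `b` along the run of the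
dynamics with drift `b` started at `w`. -/
def driftShift (b b' : (t : Fin T) → (Fin (t.val + 1) → E) → E) (σ : Fin T → ℝ) (w : E)
    (e : Fin T → E) (t : Fin T) : E :=
  (σ t)⁻¹ • (b t (history (langevinUpdate b σ) w e t.castSucc) -
    b' t (history (langevinUpdate b σ) w e t.castSucc))

theorem history_add_driftShift (hσ : ∀ t, 0 < σ t) (w : E) (e : Fin T → E) (t : Fin (T + 1)) :
    history (langevinUpdate b' σ) w (e + driftShift b b' σ w e) t =
      history (langevinUpdate b σ) w e t :=
  (history_congr fun s _ => by
    simp only [langevinUpdate, driftShift, Pi.add_apply, smul_add, smul_inv_smul₀ (hσ s).ne']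
    abel).symm

variable [MeasurableSpace E] [BorelSpace E] [SecondCountableTopology E]

theorem measurable_history_langevinUpdate (hb : ∀ t, Measurable (b t)) (t : Fin (T + 1)) :
    Measurable fun p : E × (Fin T → E) => history (langevinUpdate b σ) p.1 p.2 t :=
  measurable_history (A := E × (Fin T → E)) (Φ := fun _ => langevinUpdate b σ)
    (fun t => by unfold langevinUpdate; fun_prop) measurable_fst measurable_snd t

theorem measurable_driftShift (hb : ∀ t, Measurable (b t)) (hb' : ∀ t, Measurable (b' t)) :
    Measurable fun p : E × (Fin T → E) => driftShift b b' σ p.1 p.2 :=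
  measurable_pi_lambda _ fun t =>
    (((hb t).comp (measurable_history_langevinUpdate hb _)).sub
      ((hb' t).comp (measurable_history_langevinUpdate hb _))).const_smul _

theorem isPredictable_driftShift (hb : ∀ t, Measurable (b t)) (hb' : ∀ t, Measurable (b' t))
    (w : E) : IsPredictable (driftShift b b' σ w) where
  measurable := (measurable_driftShift hb hb').comp measurable_prodMk_left
  dependsOn t e e' h := by
    simp only [driftShift, dependsOn_history t h]

/-- The law of the initial point and of the noise of a Langevin dynamics. -/
abbrev noiseLaw (ν γ : Measure E) (T : ℕ) : Measure (E × (Fin T → E)) :=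
  ν.prod (Measure.pi fun _ => γ)

variable {γ ν : Measure E} [IsProbabilityMeasure γ] [IsProbabilityMeasure ν]

theorem integral_history_langevinUpdate_sub_le (hγ : EntropicShift γ fun x => ‖x‖ ^ 2)
    (hσ : ∀ t, 0 < σ t) (hb : ∀ t, Measurable (b t)) (hb' : ∀ t, Measurable (b' t))
    {κ : Fin T → ℝ} (hκ : ∀ t h, ‖b t h - b' t h‖ ≤ κ t)
    {F : (Fin (T + 1) → E) → ℝ} (hF : Measurable F) {M : ℝ} (hM : ∀ h, |F h| ≤ M) :
    ∫ p, F (history (langevinUpdate b σ) p.1 p.2 (Fin.last T)) ∂(noiseLaw ν γ T) -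
        ∫ p, F (history (langevinUpdate b' σ) p.1 p.2 (Fin.last T)) ∂(noiseLaw ν γ T) ≤
      M * Real.sqrt (∑ t, ∫ p, ‖driftShift b b' σ p.1 p.2 t‖ ^ 2 ∂(noiseLaw ν γ T)) := by
  have hbound (w e) (t : Fin T) : ‖driftShift b b' σ w e t‖ ^ 2 ≤ ∑ s, ((σ s)⁻¹ * κ s) ^ 2 := by
    refine le_trans ?_ (Finset.single_le_sum (f := fun s => ((σ s)⁻¹ * κ s) ^ 2)
      (fun s _ => sq_nonneg _) (Finset.mem_univ t))
    rw [driftShift, norm_smul, Real.norm_of_nonneg (inv_pos.2 (hσ t)).le]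
    have := (hσ t).le
    gcongr
    exact hκ _ _
  have hpinsker := hγ.integral_shift_sub_le (by fun_prop) (fun _ => sq_nonneg _) ν
    (measurable_driftShift hb hb') (isPredictable_driftShift hb hb') hbound
    (G := fun p => F (history (langevinUpdate b' σ) p.1 p.2 (Fin.last T)))
    (hF.comp (measurable_history_langevinUpdate hb' _)) fun _ => hM _
  simp only [history_add_driftShift hσ] at hpinsker
  exact hpinsker

end Langevin

section MixedDrift

variable {E : Type*} [NormedAddCommGroup E] [NormedSpace ℝ E] {T : ℕ} {σ : Fin T → ℝ}

/-- The mixture of the drifts `b 0` and `b 1` in which the weight of `b 1` is the estimate `π`. -/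
def mixedDrift (b : Fin 2 → (t : Fin T) → (Fin (t.val + 1) → E) → E)
    (π : (t : Fin T) → (Fin (t.val + 1) → E) → ℝ) (t : Fin T) (h : Fin (t.val + 1) → E) : E :=
  (1 - π t h) • b 0 t h + π t h • b 1 t h

variable {b : Fin 2 → (t : Fin T) → (Fin (t.val + 1) → E) → E}
  {π : (t : Fin T) → (Fin (t.val + 1) → E) → ℝ} {β : Fin T → ℝ}

theorem norm_sub_mixedDrift_le (hβ : ∀ t h, ‖b 1 t h - b 0 t h‖ ≤ β t) (c : Fin 2) (t : Fin T)
    (h : Fin (t.val + 1) → E) :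
    ‖b c t h - mixedDrift b π t h‖ ≤ |(c.val : ℝ) - π t h| * β t := by
  have hdiff : b c t h - mixedDrift b π t h = ((c.val : ℝ) - π t h) • (b 1 t h - b 0 t h) := by
    fin_cases c <;> simp [mixedDrift] <;> module
  rw [hdiff, norm_smul, Real.norm_eq_abs]
  gcongr
  exact hβ t h

theorem abs_bit_sub_le_one (c : Fin 2) {x : ℝ} (hx : x ∈ Set.Icc (0 : ℝ) 1) :
    |(c.val : ℝ) - x| ≤ 1 := by
  obtain ⟨h0, h1⟩ := hx
  fin_cases c <;> simp [abs_le] <;> constructor <;> linarith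

theorem norm_driftShift_mixedDrift_sq_le (hβ : ∀ t h, ‖b 1 t h - b 0 t h‖ ≤ β t) (c : Fin 2)
    (w : E) (e : Fin T → E) (t : Fin T) :
    ‖driftShift (b c) (mixedDrift b π) σ w e t‖ ^ 2 ≤ (β t / σ t) ^ 2 *
      ((c.val : ℝ) - π t (history (langevinUpdate (b c) σ) w e t.castSucc)) ^ 2 := by
  rw [driftShift, norm_smul, mul_pow, norm_inv, inv_pow, Real.norm_eq_abs, sq_abs, div_pow,
    div_mul_eq_mul_div, inv_mul_eq_div, ← sq_abs ((c.val : ℝ) - _), mul_comm (_ ^ 2), ← mul_pow]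
  gcongr
  exact norm_sub_mixedDrift_le hβ c t _

variable [MeasurableSpace E] [BorelSpace E] [SecondCountableTopology E] {γ ν : Measure E}
  [IsProbabilityMeasure γ] [IsProbabilityMeasure ν]

theorem measurable_mixedDrift (hb : ∀ c t, Measurable (b c t)) (hπ : ∀ t, Measurable (π t))
    (t : Fin T) : Measurable (mixedDrift b π t) := by
  unfold mixedDrift
  fun_prop

theorem integral_history_sub_mixedDrift_le (hγ : EntropicShift γ fun x => ‖x‖ ^ 2)
    (hσ : ∀ t, 0 < σ t) (hb : ∀ c t, Measurable (b c t))
    (hβ : ∀ t h, ‖b 1 t h - b 0 t h‖ ≤ β t)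
    (hπ : ∀ t, Measurable (π t)) (hπ01 : ∀ t h, π t h ∈ Set.Icc (0 : ℝ) 1)
    {F : (Fin (T + 1) → E) → ℝ} (hF : Measurable F) {M : ℝ} (hM : ∀ h, |F h| ≤ M) (c : Fin 2) :
    ∫ p, F (history (langevinUpdate (b c) σ) p.1 p.2 (Fin.last T)) ∂(noiseLaw ν γ T) -
        ∫ p, F (history (langevinUpdate (mixedDrift b π) σ) p.1 p.2 (Fin.last T))
          ∂(noiseLaw ν γ T) ≤
      M * Real.sqrt (∑ t, ∫ p, (β t / σ t) ^ 2 *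
        ((c.val : ℝ) - π t (history (langevinUpdate (b c) σ) p.1 p.2 t.castSucc)) ^ 2
          ∂(noiseLaw ν γ T)) := by
  have hM0 : 0 ≤ M :=
    (abs_nonneg _).trans (hM fun _ => (nonempty_of_isProbabilityMeasure γ).some)
  have hbound (t h) : ‖b c t h - mixedDrift b π t h‖ ≤ β t :=
    (norm_sub_mixedDrift_le hβ c t h).trans <| mul_le_of_le_one_left
      ((norm_nonneg _).trans (hβ t h)) (abs_bit_sub_le_one c (hπ01 t h))
  refine (integral_history_langevinUpdate_sub_le hγ hσ (hb c) (measurable_mixedDrift hb hπ)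
    hbound hF hM).trans ?_
  refine mul_le_mul_of_nonneg_left (Real.sqrt_le_sqrt (Finset.sum_le_sum fun t _ => ?_)) hM0
  refine integral_mono_of_nonneg (ae_of_all _ fun _ => sq_nonneg _) ?_
    (ae_of_all _ fun _ => norm_driftShift_mixedDrift_sq_le hβ c _ _ t)
  refine (integrable_of_abs_le (C := 1) ?_ fun p => ?_).const_mul _
  · exact (measurable_const.sub ((hπ t).comp
      (measurable_history_langevinUpdate (hb c) t.castSucc))).pow_const 2
  · rw [abs_pow]
    exact pow_le_one₀ (abs_nonneg _) (abs_bit_sub_le_one c (hπ01 _ _))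

theorem integral_history_sub_history_le (hγ : EntropicShift γ fun x => ‖x‖ ^ 2)
    (hσ : ∀ t, 0 < σ t) (hb : ∀ c t, Measurable (b c t))
    (hβ : ∀ t h, ‖b 1 t h - b 0 t h‖ ≤ β t)
    (hπ : ∀ t, Measurable (π t)) (hπ01 : ∀ t h, π t h ∈ Set.Icc (0 : ℝ) 1)
    {F : (Fin (T + 1) → E) → ℝ} (hF : Measurable F) {M : ℝ} (hM : ∀ h, |F h| ≤ M) :
    ∫ p, F (history (langevinUpdate (b 0) σ) p.1 p.2 (Fin.last T)) ∂(noiseLaw ν γ T) -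
        ∫ p, F (history (langevinUpdate (b 1) σ) p.1 p.2 (Fin.last T)) ∂(noiseLaw ν γ T) ≤
      ∑ c : Fin 2, M * Real.sqrt (∑ t, ∫ p, (β t / σ t) ^ 2 *
        ((c.val : ℝ) - π t (history (langevinUpdate (b c) σ) p.1 p.2 t.castSucc)) ^ 2
          ∂(noiseLaw ν γ T)) := by
  have h0 := integral_history_sub_mixedDrift_le (ν := ν) hγ hσ hb hβ hπ hπ01 hF hM 0
  have h1 := integral_history_sub_mixedDrift_le (ν := ν) hγ hσ hb hβ hπ hπ01 hF.neg
    (fun h => by simpa using hM h) 1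
  simp only [Pi.neg_apply, integral_neg] at h1
  rw [Fin.sum_univ_two]
  linarith

end MixedDrift

section Resampling

variable {ι α : Type*} [Fintype ι] [DecidableEq ι] [MeasurableSpace α]

theorem measurePreserving_update (μ : Measure α) [IsProbabilityMeasure μ] (k : ι) :
    MeasurePreserving (fun p : (ι → α) × α => Function.update p.1 k p.2)
      ((Measure.pi fun _ => μ).prod μ) (Measure.pi fun _ => μ) := by
  refine ⟨by fun_prop, (Measure.pi_eq fun s hs => ?_).symm⟩
  have hpre : (fun p : (ι → α) × α => Function.update p.1 k p.2) ⁻¹' Set.univ.pi s =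
      Set.univ.pi (Function.update s k Set.univ) ×ˢ s k := by
    ext p
    simp only [Set.mem_preimage, Set.mem_univ_pi, Set.mem_prod]
    refine ⟨fun h => ⟨fun i => ?_, by simpa using h k⟩, fun ⟨h1, h2⟩ i => ?_⟩
    · rcases eq_or_ne i k with rfl | hi
      · simp
      · simpa [hi] using h i
    · rcases eq_or_ne i k with rfl | hi
      · simpa using h2
      · simpa [hi] using h1 i
  rw [Measure.map_apply (by fun_prop) (MeasurableSet.univ_pi hs), hpre, Measure.prod_prod,
    Measure.pi_pi, ← Finset.prod_erase_mul _ _ (Finset.mem_univ k),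
    ← Finset.prod_erase_mul _ (fun i => μ (s i)) (Finset.mem_univ k), Function.update_self,
    measure_univ, mul_one]
  congr 1
  exact Finset.prod_congr rfl fun i hi => by rw [Function.update_of_ne (Finset.ne_of_mem_erase hi)]

theorem integral_pi_update {μ : Measure α} [IsProbabilityMeasure μ] {g : (ι → α) → ℝ}
    (hg : Measurable g) {C : ℝ} (hC : ∀ x, |g x| ≤ C) (k : ι) :
    ∫ s, ∫ x, g (Function.update s k x) ∂μ ∂(Measure.pi fun _ => μ) =
      ∫ s, g s ∂(Measure.pi fun _ => μ) := by
  have hmp := measurePreserving_update μ k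
  conv_rhs => rw [← hmp.map_eq, integral_map hmp.aemeasurable hg.aestronglyMeasurable]
  exact (integral_prod _ (integrable_of_abs_le (hg.comp hmp.measurable) fun _ => hC _)).symm

end Resampling

section Uniform

variable {α : Type*} [Fintype α] [Nonempty α] [MeasurableSpace α] [MeasurableSingletonClass α]

theorem integral_uniformOfFintype (f : α → ℝ) :
    ∫ x, f x ∂(PMF.uniformOfFintype α).toMeasure = (1 / (Fintype.card α : ℝ)) * ∑ x, f x := by
  rw [PMF.integral_eq_sum, Finset.mul_sum]
  exact Finset.sum_congr rfl fun x _ => by simp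

theorem integral_pi_uniformOfFintype_nonneg {ι : Type*} [Fintype ι] [DecidableEq ι]
    {g : (ι → α) → ℝ} (j : ι) (h : ∀ u, 0 ≤ ∑ c, g (Function.update u j c)) :
    0 ≤ ∫ u, g u ∂(Measure.pi fun _ => (PMF.uniformOfFintype α).toMeasure) := by
  obtain ⟨C, hC⟩ := (Set.finite_range fun u => |g u|).bddAbove
  rw [← integral_pi_update (measurable_of_countable g) (fun u => hC ⟨u, rfl⟩) j]
  refine integral_nonneg fun u => ?_
  rw [integral_uniformOfFintype]
  exact mul_nonneg (by positivity) (h u)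

theorem integral_comp_uniformOfFintype_prod {Ω B : Type*} [MeasurableSpace Ω] [MeasurableSpace B]
    {μ : Measure Ω} {P : Measure B} [IsProbabilityMeasure P] {J : Ω → α} {Y : Ω → B}
    (hJY : MeasurePreserving (fun ω => (J ω, Y ω)) μ ((PMF.uniformOfFintype α).toMeasure.prod P))
    {g : α → B → ℝ} (hg : ∀ j, Measurable (g j)) {C : ℝ} (hC : ∀ j y, |g j y| ≤ C) :
    ∫ ω, g (J ω) (Y ω) ∂μ = (1 / (Fintype.card α : ℝ)) * ∑ j, ∫ y, g j y ∂P := by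
  have hg' : Measurable fun p : α × B => g p.1 p.2 := measurable_from_prod_countable_right hg
  rw [← integral_uniformOfFintype, ← integral_prod _ (integrable_of_abs_le hg' fun _ => hC _ _),
    ← hJY.map_eq, integral_map hJY.aemeasurable hg'.aestronglyMeasurable]

end Uniform

section Conditioning

theorem measurable_apply_of_countable {α γ δ : Type*} [MeasurableSpace α] [MeasurableSpace γ]
    [MeasurableSpace δ] [Countable γ] [MeasurableSingletonClass γ] {f : α → γ → δ} {c : α → γ}
    (hf : ∀ g, Measurable fun x => f x g) (hc : Measurable c) : Measurable fun x => f x (c x) :=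
  (measurable_from_prod_countable_left (f := fun p : α × γ => f p.1 p.2) hf).comp
    (measurable_id.prodMk hc)

variable {Ω A B C : Type*} [MeasurableSpace Ω] [MeasurableSpace A] [MeasurableSpace B]
  [MeasurableSpace C] {μ : Measure Ω} [IsProbabilityMeasure μ] {X : Ω → A} {X' : Ω → B}

theorem indepFun_of_measurePreserving_prod {ρ : Measure A} {ν : Measure B} [IsProbabilityMeasure ρ]
    [IsProbabilityMeasure ν] (h : MeasurePreserving (fun ω => (X ω, X' ω)) μ (ρ.prod ν)) :
    X ⟂ᵢ[μ] X' := by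
  have hX : MeasurePreserving X μ ρ := measurePreserving_fst.comp h
  have hX' : MeasurePreserving X' μ ν := measurePreserving_snd.comp h
  rw [indepFun_iff_map_prod_eq_prod_map_map hX.aemeasurable hX'.aemeasurable, h.map_eq, hX.map_eq,
    hX'.map_eq]

theorem ae_condDistrib_eq_map_of_indepFun [StandardBorelSpace C] [Nonempty C] {Y : Ω → C}
    (hX : Measurable X) (hX' : Measurable X') (hY : Measurable Y) (hind : X ⟂ᵢ[μ] X')
    {F : A → B → C} (hF : Measurable fun p : A × B => F p.1 p.2)
    (hYF : ∀ᵐ ω ∂μ, Y ω = F (X ω) (X' ω)) :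
    ∀ᵐ ω ∂μ, condDistrib Y X μ (X ω) = (μ.map X').map (F (X ω)) := by
  have := Measure.isProbabilityMeasure_map (μ := μ) hX.aemeasurable
  have := Measure.isProbabilityMeasure_map (μ := μ) hX'.aemeasurable
  have hFx (x : A) : Measurable (F x) := hF.comp measurable_prodMk_left
  let κ : Kernel A C := (Kernel.id ×ₖ Kernel.const A (μ.map X')).map fun p => F p.1 p.2
  have : IsMarkovKernel κ := Kernel.IsMarkovKernel.map _ hF
  have hκ (x : A) : κ x = (μ.map X').map (F x) := by
    rw [Kernel.map_apply _ hF, Kernel.prod_apply, Kernel.id_apply, Kernel.const_apply,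
      Measure.dirac_prod, Measure.map_map hF measurable_prodMk_left]
    rfl
  have hcomp : μ.map (fun ω => (X ω, Y ω)) = μ.map X ⊗ₘ κ := by
    have hFm : Measurable fun p : A × B => (p.1, F p.1 p.2) := measurable_fst.prodMk hF
    calc μ.map (fun ω => (X ω, Y ω))
      _ = (μ.map fun ω => (X ω, X' ω)).map fun p => (p.1, F p.1 p.2) := by
        rw [Measure.map_map hFm (hX.prodMk hX')]
        exact Measure.map_congr (hYF.mono fun ω h => by simp [h])
      _ = ((μ.map X).prod (μ.map X')).map fun p => (p.1, F p.1 p.2) := by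
        rw [(indepFun_iff_map_prod_eq_prod_map_map hX.aemeasurable hX'.aemeasurable).1 hind]
      _ = μ.map X ⊗ₘ κ := by
        ext s hs
        rw [Measure.map_apply hFm hs, Measure.prod_apply (hFm hs), Measure.compProd_apply hs]
        refine lintegral_congr fun x => ?_
        rw [hκ, Measure.map_apply (hFx x) (measurable_prodMk_left hs)]
        rfl
  filter_upwards [ae_of_ae_map hX.aemeasurable
    (condDistrib_ae_eq_of_measure_eq_compProd_of_measurable hX hY hcomp)] with ω hω
  rw [hω, hκ]

end Conditioning

section Gradient

theorem measurable_fderiv_apply {A E : Type*} [MeasurableSpace A] [NormedAddCommGroup E]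
    [NormedSpace ℝ E] [MeasurableSpace E] [BorelSpace E] {f : A → E → ℝ}
    (hf : Measurable fun p : A × E => f p.1 p.2) (hd : ∀ z, Differentiable ℝ (f z)) (e : E) :
    Measurable fun p : A × E => fderiv ℝ (f p.1) p.2 e := by
  let c : ℕ → ℝ := fun n => (n : ℝ) + 1
  have hc : Filter.Tendsto (fun n => ‖c n‖) Filter.atTop Filter.atTop :=
    Filter.tendsto_abs_atTop_atTop.comp
      (Filter.tendsto_atTop_add_const_right _ _ tendsto_natCast_atTop_atTop)
  refine measurable_of_tendsto_metrizable
    (f := fun n (p : A × E) => c n * (f p.1 (p.2 + (c n)⁻¹ • e) - f p.1 p.2)) (fun n => ?_)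
    (tendsto_pi_nhds.2 fun p => ?_)
  · exact ((hf.comp (measurable_fst.prodMk (measurable_snd.add_const _))).sub hf).const_mul _
  · simpa only [smul_eq_mul] using (hd p.1 p.2).hasFDerivAt.lim e hc

theorem measurable_gradient {A : Type*} [MeasurableSpace A] {d : ℕ} {f : A → Param d → ℝ}
    (hf : Measurable fun p : A × Param d => f p.1 p.2) (hd : ∀ z, Differentiable ℝ (f z)) :
    Measurable fun p : A × Param d => gradient (f p.1) p.2 := by
  have hcoord : (fun p : A × Param d => gradient (f p.1) p.2) = fun p =>
      WithLp.toLp 2 fun i => fderiv ℝ (f p.1) p.2 (EuclideanSpace.single i 1) := by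
    funext p
    ext i
    change gradient (f p.1) p.2 i = fderiv ℝ (f p.1) p.2 (EuclideanSpace.single i 1)
    rw [← InnerProductSpace.toDual_symm_apply (𝕜 := ℝ) (E := Param d), ← gradient,
      EuclideanSpace.inner_single_right]
    simp
  rw [hcoord]
  exact (WithLp.measurable_toLp 2 _).comp
    (measurable_pi_lambda _ fun i => measurable_fderiv_apply hf hd _)

theorem norm_gradient_le_of_lipschitz {E : Type*} [NormedAddCommGroup E] [InnerProductSpace ℝ E]
    [CompleteSpace E] {f : E → ℝ} {L : NNReal} (hf : LipschitzWith L f) (x : E) :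
    ‖gradient f x‖ ≤ L := by
  rw [gradient, LinearIsometryEquiv.norm_map]
  exact norm_fderiv_le_of_lipschitz ℝ hf

end Gradient

section SGLDDrift

variable {𝒵 : Type*} {N d T : ℕ} {f : Param d → 𝒵 → ℝ}

theorem differentiable_empiricalRisk (hd : ∀ z, Differentiable ℝ fun x => f x z)
    (z : Fin N → 𝒵) (B : Finset (Fin N)) : Differentiable ℝ (empiricalRisk f z B) :=
  (Differentiable.fun_sum fun i _ => hd (z i)).const_mul _

theorem gradient_empiricalRisk (hd : ∀ z, Differentiable ℝ fun x => f x z) (z : Fin N → 𝒵)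
    (B : Finset (Fin N)) (x : Param d) : gradient (empiricalRisk f z B) x =
      (1 / (B.card : ℝ)) • ∑ i ∈ B, gradient (fun x => f x (z i)) x := by
  unfold empiricalRisk gradient
  rw [fderiv_const_mul (DifferentiableAt.fun_sum fun i _ => hd (z i) x),
    fderiv_fun_sum fun i _ => hd (z i) x, map_smul, map_sum]

theorem norm_gradient_empiricalRisk_sub_le (hd : ∀ z, Differentiable ℝ fun x => f x z)
    {L : NNReal} (hL : ∀ z, LipschitzWith L fun x => f x z) {z z' : Fin N → 𝒵} {j : Fin N}
    (hz : ∀ i, i ≠ j → z i = z' i) (B : Finset (Fin N)) (x : Param d) :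
    ‖gradient (empiricalRisk f z B) x - gradient (empiricalRisk f z' B) x‖ ≤
      if j ∈ B then 2 * (L : ℝ) / B.card else 0 := by
  rw [gradient_empiricalRisk hd, gradient_empiricalRisk hd, ← smul_sub, ← Finset.sum_sub_distrib]
  split_ifs with hj
  · rw [Finset.sum_eq_single_of_mem j hj fun i _ hi => by rw [hz i hi, sub_self], norm_smul,
      Real.norm_of_nonneg (by positivity), one_div, inv_mul_eq_div, two_mul]
    gcongr
    exact norm_sub_le_of_le (norm_gradient_le_of_lipschitz (hL _) x)
      (norm_gradient_le_of_lipschitz (hL _) x)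
  · rw [Finset.sum_eq_zero fun i hi => by
      rw [hz i (ne_of_mem_of_not_mem hi hj), sub_self], smul_zero, norm_zero]

/-- The drift of stochastic gradient Langevin dynamics on the dataset `z` with batches `v`: one
gradient step from the last parameter of the history. -/
def sgldDrift (f : Param d → 𝒵 → ℝ) (η : Fin T → ℝ) (z : Fin N → 𝒵) (v : Fin T → Finset (Fin N))
    (t : Fin T) (h : Fin (t.val + 1) → Param d) : Param d :=
  h (Fin.last t.val) - η t • gradient (empiricalRisk f z (v t)) (h (Fin.last t.val))

theorem norm_sgldDrift_sub_le (hd : ∀ z, Differentiable ℝ fun x => f x z)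
    {L : NNReal} (hL : ∀ z, LipschitzWith L fun x => f x z) (η : Fin T → ℝ) {z z' : Fin N → 𝒵}
    {j : Fin N} (hz : ∀ i, i ≠ j → z i = z' i) (v : Fin T → Finset (Fin N)) (t : Fin T)
    (h : Fin (t.val + 1) → Param d) :
    ‖sgldDrift f η z v t h - sgldDrift f η z' v t h‖ ≤
      |η t| * if j ∈ v t then 2 * (L : ℝ) / (v t).card else 0 := by
  rw [sgldDrift, sgldDrift, sub_sub_sub_cancel_left, ← smul_sub, norm_smul, norm_sub_rev,
    Real.norm_eq_abs]
  gcongr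
  exact norm_gradient_empiricalRisk_sub_le hd hL hz _ _

variable [MeasurableSpace 𝒵]

theorem measurable_empiricalRisk (hm : Measurable fun p : Param d × 𝒵 => f p.1 p.2)
    (B : Finset (Fin N)) :
    Measurable fun p : (Fin N → 𝒵) × Param d => empiricalRisk f p.1 B p.2 :=
  (Finset.measurable_sum _ fun i _ => hm.comp
    (measurable_snd.prodMk ((measurable_pi_apply i).comp measurable_fst))).const_mul _

theorem measurable_sgldDrift (hm : Measurable fun p : Param d × 𝒵 => f p.1 p.2)
    (hd : ∀ z, Differentiable ℝ fun x => f x z) (η : Fin T → ℝ) (v : Fin T → Finset (Fin N))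
    (t : Fin T) : Measurable fun p : (Fin N → 𝒵) × (Fin (t.val + 1) → Param d) =>
      sgldDrift f η p.1 v t p.2 := by
  have hlast : Measurable fun p : (Fin N → 𝒵) × (Fin (t.val + 1) → Param d) =>
    p.2 (Fin.last t.val) := by fun_prop
  have hgrad := (measurable_gradient (measurable_empiricalRisk hm (v t))
    fun z => differentiable_empiricalRisk hd z (v t)).comp (measurable_fst.prodMk hlast)
  exact hlast.sub (hgrad.const_smul (η t))

end SGLDDrift

section Run

/-- The data of one run of the algorithm: super-sample, bits, batches, initial parameter and
noise. -/
abbrev RunData (N : ℕ) (𝒵 : Type*) (d T : ℕ) : Type _ :=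
  SuperSample N 𝒵 × (Fin N → Fin 2) × (Fin T → Finset (Fin N)) × (Param d × (Fin T → Param d))

/-- An estimator of the bit at `j` before each update, computed from the super-sample, the other
bits, the batches and the past parameters. -/
abbrev BitEstimator {N : ℕ} (𝒵 : Type*) (d T : ℕ) (j : Fin N) : Type _ :=
  (t : Fin T) → SuperSample N 𝒵 × ({i : Fin N // i ≠ j} → Fin 2) × (Fin T → Finset (Fin N)) ×
    (Fin (t.val + 1) → Param d) → ℝ

variable {𝒵 : Type*} {N d T : ℕ}

/-- The parameters `θ 0, …, θ t` of the run with data `y`, for the loss `f` of the parameters. -/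
def trajectory (f : Param d → 𝒵 → ℝ) (η σ : Fin T → ℝ) (y : RunData N 𝒵 d T) (t : Fin (T + 1)) :
    Fin (t.val + 1) → Param d :=
  history (langevinUpdate (sgldDrift f η (dataset y.1 y.2.1) y.2.2.1) σ) y.2.2.2.1 y.2.2.2.2 t

/-- The final parameter of the run with data `y`. -/
def trainedParam (f : Param d → 𝒵 → ℝ) (η σ : Fin T → ℝ) (y : RunData N 𝒵 d T) : Param d :=
  trajectory f η σ y (Fin.last T) (Fin.last T)

/-- The loss of the final parameter at the unselected point at `j` minus its loss at the selected
one. -/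
def lossGap (f : Param d → 𝒵 → ℝ) (η σ : Fin T → ℝ) (j : Fin N) (y : RunData N 𝒵 d T) : ℝ :=
  f (trainedParam f η σ y) (y.1 (1 - y.2.1 j, j)) - f (trainedParam f η σ y) (y.1 (y.2.1 j, j))

/-- The squared error of the estimate of the bit at `j` before the update `t`, weighted by the
squared ratio of learning rate to noise level. -/
def weightedError (η σ : Fin T → ℝ) {j : Fin N} (π : BitEstimator 𝒵 d T j) (t : Fin T)
    (s : SuperSample N 𝒵) (u : Fin N → Fin 2) (v : Fin T → Finset (Fin N))
    (h : Fin (t.val + 1) → Param d) : ℝ :=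
  (η t) ^ 2 / (σ t) ^ 2 * (((u j).val : ℝ) - π t (s, bitsExcept u j, v, h)) ^ 2

/-- The root of the total mean weighted error over the updates that involve `j`, where `ν` is the
law of the initial parameter and the noise. -/
def rootError (f : Param d → 𝒵 → ℝ) (η σ : Fin T → ℝ) {j : Fin N} (π : BitEstimator 𝒵 d T j)
    (ν : Measure (Param d × (Fin T → Param d))) (s : SuperSample N 𝒵) (u : Fin N → Fin 2)
    (v : Fin T → Finset (Fin N)) : ℝ :=
  Real.sqrt (∑ t ∈ itersWith v j,
    ∫ x, weightedError η σ π t s u v (trajectory f η σ (s, u, v, x) t.castSucc) ∂ν)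

variable {f : Param d → 𝒵 → ℝ} {j : Fin N} {π : BitEstimator 𝒵 d T j}

theorem dataset_update_unselected (s : SuperSample N 𝒵) (u : Fin N → Fin 2) (j : Fin N) (z : 𝒵) :
    dataset (Function.update s (1 - u j, j) z) u = dataset s u := by
  have hne (c : Fin 2) : c ≠ 1 - c := by fin_cases c <;> decide
  funext i
  refine Function.update_of_ne (fun h => ?_) _ _
  obtain ⟨hbit, rfl⟩ := Prod.mk.inj h
  exact hne _ hbit

theorem abs_lossGap_le {a b : ℝ} (hab : ∀ x z, f x z ∈ Set.Icc a b) (η σ : Fin T → ℝ) (j : Fin N)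
    (y : RunData N 𝒵 d T) : |lossGap f η σ j y| ≤ b - a :=
  abs_sub_le_of_le_of_le (hab _ _).1 (hab _ _).2 (hab _ _).1 (hab _ _).2

theorem abs_weightedError_le (hπ01 : ∀ t x, π t x ∈ Set.Icc (0 : ℝ) 1) (η σ : Fin T → ℝ)
    (t : Fin T) (s : SuperSample N 𝒵) (u : Fin N → Fin 2) (v : Fin T → Finset (Fin N))
    (h : Fin (t.val + 1) → Param d) : |weightedError η σ π t s u v h| ≤ (η t) ^ 2 / (σ t) ^ 2 := by
  rw [weightedError, abs_mul, abs_of_nonneg (by positivity : 0 ≤ (η t) ^ 2 / (σ t) ^ 2), abs_pow]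
  exact mul_le_of_le_one_right (by positivity)
    (pow_le_one₀ (abs_nonneg _) (abs_bit_sub_le_one _ (hπ01 _ _)))

theorem abs_rootError_le (hπ01 : ∀ t x, π t x ∈ Set.Icc (0 : ℝ) 1) (η σ : Fin T → ℝ)
    (ν : Measure (Param d × (Fin T → Param d))) [IsProbabilityMeasure ν] (s : SuperSample N 𝒵)
    (u : Fin N → Fin 2) (v : Fin T → Finset (Fin N)) :
    |rootError f η σ π ν s u v| ≤ Real.sqrt (∑ t, (η t) ^ 2 / (σ t) ^ 2) := by
  rw [rootError, abs_of_nonneg (Real.sqrt_nonneg _)]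
  refine Real.sqrt_le_sqrt ((Finset.sum_le_sum fun t _ => ?_).trans
    (Finset.sum_le_univ_sum_of_nonneg fun t => by positivity))
  exact (le_abs_self _).trans (abs_integral_le_of_abs_le fun _ =>
    abs_weightedError_le hπ01 _ _ _ _ _ _ _)

theorem rootError_update (ν : Measure (Param d × (Fin T → Param d))) (η σ : Fin T → ℝ)
    (s : SuperSample N 𝒵) (u : Fin N → Fin 2) (v : Fin T → Finset (Fin N)) (c : Fin 2) :
    rootError f η σ π ν s (Function.update u j c) v =
      Real.sqrt (∑ t ∈ itersWith v j, (η t) ^ 2 / (σ t) ^ 2 *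
        ∫ x, ((c.val : ℝ) - π t (s, bitsExcept u j, v,
          history (langevinUpdate (sgldDrift f η (dataset s (Function.update u j c)) v) σ)
            x.1 x.2 t.castSucc)) ^ 2 ∂ν) := by
  have hbits : bitsExcept (Function.update u j c) j = bitsExcept u j :=
    funext fun i => Function.update_of_ne i.2 _ _
  simp only [rootError, weightedError, trajectory, hbits, Function.update_self, integral_const_mul]

section Measurability

variable [MeasurableSpace 𝒵]

theorem measurable_trajectory (hm : Measurable fun p : Param d × 𝒵 => f p.1 p.2)
    (hd : ∀ z, Differentiable ℝ fun x => f x z) (η σ : Fin T → ℝ) (t : Fin (T + 1)) :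
    Measurable fun y : RunData N 𝒵 d T => trajectory f η σ y t := by
  have hfixed (c : (Fin N → Fin 2) × (Fin T → Finset (Fin N))) : Measurable
      fun y : RunData N 𝒵 d T => trajectory f η σ (y.1, c.1, c.2, y.2.2.2) t := by
    have hdata : Measurable fun y : RunData N 𝒵 d T => dataset y.1 c.1 :=
      measurable_pi_lambda _ fun i => (measurable_pi_apply _).comp measurable_fst
    refine measurable_history (fun r => Measurable.add ?_ (measurable_snd.snd.const_smul (σ r)))
      measurable_snd.snd.snd.fst measurable_snd.snd.snd.snd t
    exact (measurable_sgldDrift hm hd η c.2 r).comp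
      ((hdata.comp measurable_fst).prodMk measurable_snd.fst)
  exact measurable_apply_of_countable hfixed
    (c := fun y : RunData N 𝒵 d T => (y.2.1, y.2.2.1))
    (measurable_snd.fst.prodMk measurable_snd.snd.fst)

theorem measurable_trainedParam (hm : Measurable fun p : Param d × 𝒵 => f p.1 p.2)
    (hd : ∀ z, Differentiable ℝ fun x => f x z) (η σ : Fin T → ℝ) :
    Measurable fun y : RunData N 𝒵 d T => trainedParam f η σ y :=
  (measurable_pi_apply _).comp (measurable_trajectory hm hd η σ (Fin.last T))

theorem measurable_loss_trainedParam (hm : Measurable fun p : Param d × 𝒵 => f p.1 p.2)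
    (hd : ∀ z, Differentiable ℝ fun x => f x z) (η σ : Fin T → ℝ) (r : Fin 2 → Fin 2)
    (j : Fin N) :
    Measurable fun y : RunData N 𝒵 d T => f (trainedParam f η σ y) (y.1 (r (y.2.1 j), j)) := by
  have hpoint : Measurable fun y : RunData N 𝒵 d T => y.1 (r (y.2.1 j), j) :=
    measurable_apply_of_countable (f := fun (y : RunData N 𝒵 d T) c => y.1 (r c, j))
      (fun c => by fun_prop) ((measurable_pi_apply j).comp measurable_snd.fst)
  exact hm.comp ((measurable_trainedParam hm hd η σ).prodMk hpoint)

theorem measurable_lossGap (hm : Measurable fun p : Param d × 𝒵 => f p.1 p.2)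
    (hd : ∀ z, Differentiable ℝ fun x => f x z) (η σ : Fin T → ℝ) (j : Fin N) :
    Measurable fun y : RunData N 𝒵 d T => lossGap f η σ j y :=
  (measurable_loss_trainedParam hm hd η σ (fun c => 1 - c) j).sub
    (measurable_loss_trainedParam hm hd η σ id j)

theorem measurable_weightedError (hπ : ∀ t, Measurable (π t)) (η σ : Fin T → ℝ) (t : Fin T) :
    Measurable fun p : SuperSample N 𝒵 × (Fin N → Fin 2) × (Fin T → Finset (Fin N)) ×
      (Fin (t.val + 1) → Param d) => weightedError η σ π t p.1 p.2.1 p.2.2.1 p.2.2.2 := by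
  have hbit : Measurable fun c : Fin 2 => (c.val : ℝ) := measurable_of_countable _
  have hrest : Measurable fun u : Fin N → Fin 2 => bitsExcept u j := measurable_of_countable _
  unfold weightedError
  fun_prop

theorem measurable_rootError (hm : Measurable fun p : Param d × 𝒵 => f p.1 p.2)
    (hd : ∀ z, Differentiable ℝ fun x => f x z) (hπ : ∀ t, Measurable (π t)) (η σ : Fin T → ℝ)
    (ν : Measure (Param d × (Fin T → Param d))) [SFinite ν] :
    Measurable fun y : RunData N 𝒵 d T => rootError f η σ π ν y.1 y.2.1 y.2.2.1 := by
  refine measurable_apply_of_countable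
    (f := fun (y : RunData N 𝒵 d T) v => rootError f η σ π ν y.1 y.2.1 v)
    (fun v => (Finset.measurable_sum _ fun t _ => ?_).sqrt) measurable_snd.snd.fst
  have hrun : Measurable fun p : RunData N 𝒵 d T × Param d × (Fin T → Param d) =>
      trajectory f η σ (p.1.1, p.1.2.1, v, p.2) t.castSucc :=
    (measurable_trajectory hm hd η σ t.castSucc).comp (by fun_prop)
  exact ((measurable_weightedError hπ η σ t).comp (measurable_fst.fst.prodMk
    (measurable_fst.snd.fst.prodMk (measurable_const.prodMk hrun)))
      ).stronglyMeasurable.integral_prod_right'.measurable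

end Measurability

theorem sum_batchWeight_sq_mul (κ : ℝ) (η σ : Fin T → ℝ) (v : Fin T → Finset (Fin N)) (j : Fin N)
    (x : Fin T → ℝ) :
    ∑ t, ((|η t| * if j ∈ v t then κ else 0) / σ t) ^ 2 * x t =
      κ ^ 2 * ∑ t ∈ itersWith v j, (η t) ^ 2 / (σ t) ^ 2 * x t := by
  rw [itersWith, Finset.sum_filter, Finset.mul_sum]
  refine Finset.sum_congr rfl fun t _ => ?_
  split_ifs
  · rw [div_pow, mul_pow, sq_abs]
    ring
  · simp

/-- The two values of the bit at `j` are treated together: the reference runs of the two values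
coincide, and the gap changes sign with the bit, so their contributions cancel. -/
theorem sum_integral_lossGap_le [MeasurableSpace 𝒵]
    (hm : Measurable fun p : Param d × 𝒵 => f p.1 p.2) {a b : ℝ}
    (hab : ∀ x z, f x z ∈ Set.Icc a b) (hd : ∀ z, Differentiable ℝ fun x => f x z) {L : NNReal}
    (hL : ∀ z, LipschitzWith L fun x => f x z) (η : Fin T → ℝ) {σ : Fin T → ℝ}
    (hσ : ∀ t, 0 < σ t) (hπ : ∀ t, Measurable (π t))
    (hπ01 : ∀ t x, π t x ∈ Set.Icc (0 : ℝ) 1) (ν₀ : Measure (Param d)) [IsProbabilityMeasure ν₀]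
    (s : SuperSample N 𝒵) (u : Fin N → Fin 2) {v : Fin T → Finset (Fin N)} {K : ℕ}
    (hv : ∀ t, (v t).card = K) :
    ∑ c, ∫ x, lossGap f η σ j (s, Function.update u j c, v, x)
        ∂(noiseLaw ν₀ (stdGaussian (Param d)) T) ≤
      ∑ c, 2 * (L : ℝ) / K * (b - a) *
        rootError f η σ π (noiseLaw ν₀ (stdGaussian (Param d)) T) s (Function.update u j c) v := by
  let z (c : Fin 2) : Fin N → 𝒵 := dataset s (Function.update u j c)
  have hz : ∀ i, i ≠ j → z 1 i = z 0 i := fun i hi => by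
    simp only [z, dataset, Function.update_of_ne hi]
  have hdrift (t h) : ‖sgldDrift f η (z 1) v t h - sgldDrift f η (z 0) v t h‖ ≤
      |η t| * if j ∈ v t then 2 * (L : ℝ) / K else 0 := by
    simpa only [hv] using norm_sgldDrift_sub_le hd hL η hz v t h
  have hloss (c : Fin 2) : Measurable fun x => f x (s (c, j)) := hm.comp measurable_prodMk_right
  have hruns := integral_history_sub_history_le (ν := ν₀) (entropicShift_stdGaussian d) hσ
    (b := fun c => sgldDrift f η (z c) v)
    (fun c t => (measurable_sgldDrift hm hd η v t).comp measurable_prodMk_left) hdrift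
    (π := fun t h => π t (s, bitsExcept u j, v, h)) (fun t => (hπ t).comp (by fun_prop))
    (fun t h => hπ01 t _)
    (F := fun h => f (h (Fin.last T)) (s (1, j)) - f (h (Fin.last T)) (s (0, j)))
    (((hloss 1).sub (hloss 0)).comp (measurable_pi_apply _))
    fun h => abs_sub_le_of_le_of_le (hab _ _).1 (hab _ _).2 (hab _ _).1 (hab _ _).2
  have hgap (x) : lossGap f η σ j (s, Function.update u j 1, v, x) =
      -(f (trainedParam f η σ (s, Function.update u j 1, v, x)) (s (1, j)) -
        f (trainedParam f η σ (s, Function.update u j 1, v, x)) (s (0, j))) := by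
    simp [lossGap]
  simp only [integral_const_mul, sum_batchWeight_sq_mul, Real.sqrt_mul (sq_nonneg _),
    Real.sqrt_sq (by positivity : 0 ≤ 2 * (L : ℝ) / K), z, ← rootError_update] at hruns
  simp only [mul_comm _ (b - a), mul_assoc (b - a)]
  refine le_trans (le_of_eq ?_) hruns
  rw [Fin.sum_univ_two, sub_eq_add_neg, ← integral_neg]
  simp only [hgap]
  simp [lossGap, trainedParam, trajectory]

end Run

section Risk

variable {𝒵 : Type*} [MeasurableSpace 𝒵] {N d T : ℕ}

/-- The joint law of the data of a run: i.i.d. points, fair bits, batches with law `ρ`, and initial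
parameter and noise with law `ν`. -/
abbrev runLaw (PZ : Measure 𝒵) (N : ℕ) {d T : ℕ} (ρ : Measure (Fin T → Finset (Fin N)))
    (ν : Measure (Param d × (Fin T → Param d))) : Measure (RunData N 𝒵 d T) :=
  (Measure.pi fun _ : Fin 2 × Fin N => PZ).prod
    ((Measure.pi fun _ : Fin N => (PMF.uniformOfFintype (Fin 2)).toMeasure).prod (ρ.prod ν))

variable {PZ : Measure 𝒵} [IsProbabilityMeasure PZ] {ρ : Measure (Fin T → Finset (Fin N))}
  [IsProbabilityMeasure ρ]

theorem integral_runLaw_nonneg {ν : Measure (Param d × (Fin T → Param d))} [IsProbabilityMeasure ν]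
    {F : RunData N 𝒵 d T → ℝ} (hF : Measurable F) {C : ℝ} (hC : ∀ y, |F y| ≤ C) (j : Fin N)
    (h : ∀ s u, ∀ᵐ v ∂ρ, 0 ≤ ∑ c, ∫ x, F (s, Function.update u j c, v, x) ∂ν) :
    0 ≤ ∫ y, F y ∂(runLaw PZ N ρ ν) := by
  rw [integral_prod _ (integrable_of_abs_le hF hC)]
  refine integral_nonneg fun s => ?_
  have hs : Measurable fun q => F (s, q) := hF.comp measurable_prodMk_left
  rw [Pi.zero_apply, integral_prod _ (integrable_of_abs_le hs fun _ => hC _)]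
  refine integral_pi_uniformOfFintype_nonneg j fun u => ?_
  have hint (u : Fin N → Fin 2) : Integrable (fun q => F (s, u, q)) (ρ.prod ν) :=
    integrable_of_abs_le (hs.comp measurable_prodMk_left) fun _ => hC _
  simp only [integral_prod _ (hint _)]
  rw [← integral_finsetSum _ fun c _ => (hint _).integral_prod_left]
  exact integral_nonneg_of_ae (h s u)

variable {f : Param d → 𝒵 → ℝ}

theorem integral_lossGap_le (hm : Measurable fun p : Param d × 𝒵 => f p.1 p.2) {a b : ℝ}
    (hab : ∀ x z, f x z ∈ Set.Icc a b) (hd : ∀ z, Differentiable ℝ fun x => f x z) {L : NNReal}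
    (hL : ∀ z, LipschitzWith L fun x => f x z) (η : Fin T → ℝ) {σ : Fin T → ℝ}
    (hσ : ∀ t, 0 < σ t) {j : Fin N} {π : BitEstimator 𝒵 d T j} (hπ : ∀ t, Measurable (π t))
    (hπ01 : ∀ t x, π t x ∈ Set.Icc (0 : ℝ) 1) {ν₀ : Measure (Param d)} [IsProbabilityMeasure ν₀]
    {K : ℕ} (hρ : ∀ᵐ v ∂ρ, ∀ t, (v t).card = K) :
    ∫ y, lossGap f η σ j y ∂(runLaw PZ N ρ (noiseLaw ν₀ (stdGaussian (Param d)) T)) ≤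
      2 * (L : ℝ) / K * (b - a) *
        ∫ y, rootError f η σ π (noiseLaw ν₀ (stdGaussian (Param d)) T) y.1 y.2.1 y.2.2.1
          ∂(runLaw PZ N ρ (noiseLaw ν₀ (stdGaussian (Param d)) T)) := by
  set ν := noiseLaw ν₀ (stdGaussian (Param d)) T
  set c := 2 * (L : ℝ) / K * (b - a)
  have hgap := measurable_lossGap (T := T) hm hd η σ j
  have hroot := (measurable_rootError hm hd hπ η σ ν).const_mul c
  have hgapC := abs_lossGap_le (T := T) hab η σ j
  have hrootC (s u v) : |c * rootError f η σ π ν s u v| ≤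
      |c| * Real.sqrt (∑ t, (η t) ^ 2 / (σ t) ^ 2) := by
    rw [abs_mul]
    exact mul_le_mul_of_nonneg_left (abs_rootError_le hπ01 η σ ν s u v) (abs_nonneg c)
  rw [← integral_const_mul, ← sub_nonneg, ← integral_sub
    (integrable_of_abs_le hroot fun _ => hrootC _ _ _) (integrable_of_abs_le hgap hgapC)]
  refine integral_runLaw_nonneg (hroot.sub hgap)
    (fun y => (abs_sub _ _).trans (add_le_add (hrootC _ _ _) (hgapC y))) j
    fun s u => hρ.mono fun v hv => ?_
  have hgapx (u) : Integrable (fun x => lossGap f η σ j (s, u, v, x)) ν :=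
    integrable_of_abs_le (hgap.comp (by fun_prop)) fun _ => hgapC _
  simp only [integral_sub (integrable_const _) (hgapx _), integral_const, probReal_univ, one_smul]
  rw [Finset.sum_sub_distrib, sub_nonneg]
  exact sum_integral_lossGap_le hm hab hd hL η hσ hπ hπ01 ν₀ s u hv

theorem measurable_populationRisk_trainedParam
    (hm : Measurable fun p : Param d × 𝒵 => f p.1 p.2)
    (hd : ∀ z, Differentiable ℝ fun x => f x z) (η σ : Fin T → ℝ) :
    Measurable fun y : RunData N 𝒵 d T => populationRisk f PZ (trainedParam f η σ y) :=
  (hm.stronglyMeasurable.integral_prod_right'.measurable).comp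
    (measurable_trainedParam hm hd η σ)

variable {ν : Measure (Param d × (Fin T → Param d))} [IsProbabilityMeasure ν] {M : ℝ}

theorem integral_loss_unselected (hm : Measurable fun p : Param d × 𝒵 => f p.1 p.2)
    (hM : ∀ x z, |f x z| ≤ M) (hd : ∀ z, Differentiable ℝ fun x => f x z) (η σ : Fin T → ℝ)
    (j : Fin N) :
    ∫ y, f (trainedParam f η σ y) (y.1 (1 - y.2.1 j, j)) ∂(runLaw PZ N ρ ν) =
      ∫ y, populationRisk f PZ (trainedParam f η σ y) ∂(runLaw PZ N ρ ν) := by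
  have hloss := measurable_loss_trainedParam (N := N) (T := T) hm hd η σ (fun c => 1 - c) j
  have hrisk := measurable_populationRisk_trainedParam (PZ := PZ) (N := N) (T := T) hm hd η σ
  rw [integral_prod_symm _ (integrable_of_abs_le hloss fun _ => hM _ _),
    integral_prod_symm _ (integrable_of_abs_le hrisk fun _ => abs_integral_le_of_abs_le (hM _))]
  congr 1 with r
  refine (integral_pi_update (hloss.comp measurable_prodMk_right) (fun _ => hM _ _)
    (1 - r.1 j, j)).symm.trans ?_
  simp only [Function.comp_apply, trainedParam, trajectory, dataset_update_unselected,
    Function.update_self, populationRisk]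

theorem integral_lossGap_eq (hm : Measurable fun p : Param d × 𝒵 => f p.1 p.2)
    (hM : ∀ x z, |f x z| ≤ M) (hd : ∀ z, Differentiable ℝ fun x => f x z) (η σ : Fin T → ℝ)
    (j : Fin N) :
    ∫ y, lossGap f η σ j y ∂(runLaw PZ N ρ ν) =
      ∫ y, populationRisk f PZ (trainedParam f η σ y) ∂(runLaw PZ N ρ ν) -
        ∫ y, f (trainedParam f η σ y) (dataset y.1 y.2.1 j) ∂(runLaw PZ N ρ ν) := by
  rw [← integral_loss_unselected hm hM hd η σ j]
  exact integral_sub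
    (integrable_of_abs_le (measurable_loss_trainedParam hm hd η σ (fun c => 1 - c) j)
      fun _ => hM _ _)
    (integrable_of_abs_le (measurable_loss_trainedParam hm hd η σ id j) fun _ => hM _ _)

theorem measurable_genError_trainedParam (hm : Measurable fun p : Param d × 𝒵 => f p.1 p.2)
    (hd : ∀ z, Differentiable ℝ fun x => f x z) (η σ : Fin T → ℝ) :
    Measurable fun y : RunData N 𝒵 d T =>
      genError f PZ (trainedParam f η σ y) (dataset y.1 y.2.1) :=
  (measurable_populationRisk_trainedParam hm hd η σ).sub ((Finset.measurable_sum _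
    fun j _ => measurable_loss_trainedParam hm hd η σ id j).const_mul _)

theorem integral_genError_eq [NeZero N] (hm : Measurable fun p : Param d × 𝒵 => f p.1 p.2)
    (hM : ∀ x z, |f x z| ≤ M) (hd : ∀ z, Differentiable ℝ fun x => f x z) (η σ : Fin T → ℝ) :
    ∫ y, genError f PZ (trainedParam f η σ y) (dataset y.1 y.2.1) ∂(runLaw PZ N ρ ν) =
      (1 / (N : ℝ)) * ∑ j, ∫ y, lossGap f η σ j y ∂(runLaw PZ N ρ ν) := by
  have hloss (j : Fin N) : Integrable (fun y => f (trainedParam f η σ y) (dataset y.1 y.2.1 j))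
      (runLaw PZ N ρ ν) :=
    integrable_of_abs_le (measurable_loss_trainedParam hm hd η σ id j) fun _ => hM _ _
  have hrisk : Integrable (fun y => populationRisk f PZ (trainedParam f η σ y))
      (runLaw PZ N ρ ν) :=
    integrable_of_abs_le (measurable_populationRisk_trainedParam hm hd η σ)
      fun _ => abs_integral_le_of_abs_le (hM _)
  have hN : (N : ℝ) ≠ 0 := NeZero.ne _
  simp only [genError, empiricalRisk, integral_lossGap_eq hm hM hd, Finset.sum_sub_distrib]
  rw [integral_sub hrisk ((integrable_finsetSum _ fun j _ => hloss j).const_mul _),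
    integral_const_mul, integral_finsetSum _ fun j _ => hloss j]
  simp only [Finset.sum_const, Finset.card_univ, Fintype.card_fin, nsmul_eq_mul]
  field_simp

theorem integral_genError_le [NeZero N] (hm : Measurable fun p : Param d × 𝒵 => f p.1 p.2)
    {a b : ℝ} (hab : ∀ x z, f x z ∈ Set.Icc a b) (hd : ∀ z, Differentiable ℝ fun x => f x z)
    {L : NNReal} (hL : ∀ z, LipschitzWith L fun x => f x z) (η : Fin T → ℝ) {σ : Fin T → ℝ}
    (hσ : ∀ t, 0 < σ t) {π : (j : Fin N) → BitEstimator 𝒵 d T j}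
    (hπ : ∀ j t, Measurable (π j t)) (hπ01 : ∀ j t x, π j t x ∈ Set.Icc (0 : ℝ) 1)
    {ν₀ : Measure (Param d)} [IsProbabilityMeasure ν₀] {K : ℕ}
    (hρ : ∀ᵐ v ∂ρ, ∀ t, (v t).card = K) :
    ∫ y, genError f PZ (trainedParam f η σ y) (dataset y.1 y.2.1)
        ∂(runLaw PZ N ρ (noiseLaw ν₀ (stdGaussian (Param d)) T)) ≤
      2 * (L : ℝ) / K * (b - a) * ((1 / (N : ℝ)) * ∑ j,
        ∫ y, rootError f η σ (π j) (noiseLaw ν₀ (stdGaussian (Param d)) T) y.1 y.2.1 y.2.2.1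
          ∂(runLaw PZ N ρ (noiseLaw ν₀ (stdGaussian (Param d)) T))) := by
  rw [integral_genError_eq hm (fun x z => abs_le_max_abs_abs (hab x z).1 (hab x z).2) hd,
    mul_left_comm, Finset.mul_sum _ _ (2 * (L : ℝ) / K * (b - a))]
  gcongr with j
  exact integral_lossGap_le hm hab hd hL η hσ (hπ j) (hπ01 j) hρ

end Risk

section TrajectoryLaw

variable {𝒵 : Type*} {N d T : ℕ} {f : Param d → 𝒵 → ℝ} {η σ : Fin T → ℝ}

theorem trajectory_congr_batches {s : SuperSample N 𝒵} {u : Fin N → Fin 2}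
    {v v' : Fin T → Finset (Fin N)} {x : Param d × (Fin T → Param d)} {t : Fin T}
    (h : batchesBefore v t = batchesBefore v' t) :
    trajectory f η σ (s, u, v, x) t.castSucc = trajectory f η σ (s, u, v', x) t.castSucc :=
  history_congr fun r hr => by
    have hv : v r = v' r := congrFun h ⟨r.val, hr⟩
    simp only [langevinUpdate, sgldDrift, hv]

theorem eq_trajectory {𝒲 : Type*} {ℓ : 𝒲 → 𝒵 → ℝ} {hyp : Param d → 𝒲} {s : SuperSample N 𝒵}
    {u : Fin N → Fin 2} {v : Fin T → Finset (Fin N)} {p : Fin (T + 1) → Param d}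
    {e : Fin T → Param d}
    (hp : ∀ t : Fin T, p t.succ =
      sgldStep ℓ hyp (dataset s u) (v t) (η t) (σ t) (p t.castSucc) (e t)) (t : Fin (T + 1)) :
    (fun r : Fin (t.val + 1) => p (r.castLE t.isLt)) =
      trajectory (fun x => ℓ (hyp x)) η σ (s, u, v, p 0, e) t :=
  eq_history rfl hp t

theorem integral_weightedError_map_trajectory [MeasurableSpace 𝒵]
    (hm : Measurable fun p : Param d × 𝒵 => f p.1 p.2)
    (hd : ∀ z, Differentiable ℝ fun x => f x z) {j : Fin N} {π : BitEstimator 𝒵 d T j}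
    (hπ : ∀ t, Measurable (π t)) (ν : Measure (Param d × (Fin T → Param d)))
    (s : SuperSample N 𝒵) (u : Fin N → Fin 2) (v : Fin T → Finset (Fin N)) (t : Fin T) :
    ∫ h, weightedError η σ π t s u v h
        ∂(ν.map fun x => trajectory f η σ (s, u, v, x) t.castSucc) =
      ∫ x, weightedError η σ π t s u v
        (trajectory f η σ (s, u, v, x) t.castSucc) ∂ν := by
  have hrun : Measurable fun x => trajectory f η σ (s, u, v, x) t.castSucc :=
    (measurable_trajectory hm hd η σ t.castSucc).comp (measurable_const.prodMk
      (measurable_const.prodMk (measurable_const.prodMk measurable_id)))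
  have herror : Measurable fun h => weightedError η σ π t s u v h := by
    unfold weightedError
    fun_prop
  exact integral_map hrun.aemeasurable herror.aestronglyMeasurable

variable {Ω : Type*} [MeasurableSpace Ω] [MeasurableSpace 𝒵] {μ : Measure Ω} {PZ : Measure 𝒵}
  [IsProbabilityMeasure PZ] {ρ : Measure (Fin T → Finset (Fin N))}
  {ν : Measure (Param d × (Fin T → Param d))} {Y : Ω → RunData N 𝒵 d T}

theorem integral_genError_eq_integral_runLaw (hm : Measurable fun p : Param d × 𝒵 => f p.1 p.2)
    (hd : ∀ z, Differentiable ℝ fun x => f x z) (hY : MeasurePreserving Y μ (runLaw PZ N ρ ν))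
    {ϑ : Ω → Param d} (hϑ : ∀ᵐ ω ∂μ, ϑ ω = trainedParam f η σ (Y ω)) :
    ∫ ω, genError f PZ (ϑ ω) (dataset (Y ω).1 (Y ω).2.1) ∂μ =
      ∫ y, genError f PZ (trainedParam f η σ y) (dataset y.1 y.2.1) ∂(runLaw PZ N ρ ν) := by
  rw [← hY.map_eq, integral_map hY.aemeasurable
    (measurable_genError_trainedParam hm hd η σ).aestronglyMeasurable]
  exact integral_congr_ae (hϑ.mono fun ω hω => by simp only [hω])

variable [IsProbabilityMeasure μ] [IsProbabilityMeasure ρ] [IsProbabilityMeasure ν]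

theorem indepFun_of_measurePreserving_runLaw (hY : MeasurePreserving Y μ (runLaw PZ N ρ ν)) :
    (fun ω => ((Y ω).1, (Y ω).2.1, (Y ω).2.2.1)) ⟂ᵢ[μ] fun ω => (Y ω).2.2.2 :=
  indepFun_of_measurePreserving_prod <| ((measurePreserving_prodAssoc _ _ ν).symm.comp
    ((MeasurePreserving.id _).prod (measurePreserving_prodAssoc _ ρ ν).symm)).comp hY

theorem ae_trajectoryLaw_eq_map (hm : Measurable fun p : Param d × 𝒵 => f p.1 p.2)
    (hd : ∀ z, Differentiable ℝ fun x => f x z) (hY : MeasurePreserving Y μ (runLaw PZ N ρ ν))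
    {θ : Fin (T + 1) → Ω → Param d} (hθ : ∀ t, Measurable (θ t)) {t : Fin T}
    (hθY : ∀ᵐ ω ∂μ, paramsUpTo (fun s => θ s ω) t = trajectory f η σ (Y ω) t.castSucc) :
    ∀ᵐ ω ∂μ, trajectoryLaw μ (fun ω => (Y ω).1) (fun ω => (Y ω).2.1) (fun ω => (Y ω).2.2.1) θ t
        ((Y ω).2.1, (Y ω).1, batchesBefore (Y ω).2.2.1 t) =
      ν.map fun x => trajectory f η σ ((Y ω).1, (Y ω).2.1, (Y ω).2.2.1, x) t.castSucc := by
  let extend (w : Fin t.val → Finset (Fin N)) (s : Fin T) : Finset (Fin N) :=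
    if h : s.val < t.val then w ⟨s.val, h⟩ else ∅
  have hextend (w) : batchesBefore (extend w) t = w := funext fun s => dif_pos s.isLt
  let reorder (q : SuperSample N 𝒵 × (Fin N → Fin 2) × (Fin T → Finset (Fin N))) :
      (Fin N → Fin 2) × SuperSample N 𝒵 × (Fin t.val → Finset (Fin N)) :=
    (q.2.1, q.1, batchesBefore q.2.2 t)
  have hreorder : Measurable reorder := measurable_snd.fst.prodMk
    (measurable_fst.prodMk ((measurable_of_countable
      fun v : Fin T → Finset (Fin N) => batchesBefore v t).comp measurable_snd.snd))
  have hrun : Measurable fun p : ((Fin N → Fin 2) × SuperSample N 𝒵 ×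
      (Fin t.val → Finset (Fin N))) × Param d × (Fin T → Param d) =>
      trajectory f η σ (p.1.2.1, p.1.1, extend p.1.2.2, p.2) t.castSucc :=
    (measurable_trajectory hm hd η σ t.castSucc).comp (measurable_fst.snd.fst.prodMk
      (measurable_fst.fst.prodMk (((measurable_of_countable extend).comp
        measurable_fst.snd.snd).prodMk measurable_snd)))
  have hnoise : MeasurePreserving (fun ω => (Y ω).2.2.2) μ ν :=
    measurePreserving_snd.comp (measurePreserving_snd.comp (measurePreserving_snd.comp hY))
  have hlaw := ae_condDistrib_eq_map_of_indepFun
    (F := fun q x => trajectory f η σ (q.2.1, q.1, extend q.2.2, x) t.castSucc)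
    (hreorder.comp (hY.measurable.fst.prodMk
      (hY.measurable.snd.fst.prodMk hY.measurable.snd.snd.fst))) hnoise.measurable
    (measurable_pi_lambda _ fun s => hθ _)
    ((indepFun_of_measurePreserving_runLaw hY).comp hreorder measurable_id) hrun
    (hθY.mono fun ω hω => hω.trans (trajectory_congr_batches (hextend _).symm))
  filter_upwards [hlaw] with ω hω
  refine hω.trans ?_
  rw [hnoise.map_eq]
  congr 1 with x : 1
  exact trajectory_congr_batches (hextend _)

theorem integral_sqrt_sum_trajectoryLaw_eq [NeZero N]
    (hm : Measurable fun p : Param d × 𝒵 => f p.1 p.2)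
    (hd : ∀ z, Differentiable ℝ fun x => f x z) {J : Ω → Fin N}
    (hJY : MeasurePreserving (fun ω => (J ω, Y ω)) μ
      ((PMF.uniformOfFintype (Fin N)).toMeasure.prod (runLaw PZ N ρ ν)))
    {θ : Fin (T + 1) → Ω → Param d} (hθ : ∀ t, Measurable (θ t))
    (hθY : ∀ᵐ ω ∂μ, ∀ t, paramsUpTo (fun s => θ s ω) t = trajectory f η σ (Y ω) t.castSucc)
    {π : (j : Fin N) → BitEstimator 𝒵 d T j} (hπ : ∀ j t, Measurable (π j t))
    (hπ01 : ∀ j t x, π j t x ∈ Set.Icc (0 : ℝ) 1) :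
    ∫ ω, Real.sqrt (∑ t ∈ itersWith (Y ω).2.2.1 (J ω),
        ∫ h, weightedError η σ (π (J ω)) t (Y ω).1 (Y ω).2.1 (Y ω).2.2.1 h
          ∂(trajectoryLaw μ (fun ω => (Y ω).1) (fun ω => (Y ω).2.1) (fun ω => (Y ω).2.2.1) θ t
            ((Y ω).2.1, (Y ω).1, batchesBefore (Y ω).2.2.1 t))) ∂μ =
      (1 / (N : ℝ)) * ∑ j, ∫ y, rootError f η σ (π j) ν y.1 y.2.1 y.2.2.1 ∂(runLaw PZ N ρ ν) := by
  have hY : MeasurePreserving Y μ (runLaw PZ N ρ ν) := measurePreserving_snd.comp hJY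
  have haverage := integral_comp_uniformOfFintype_prod hJY
    (fun j => measurable_rootError hm hd (hπ j) η σ ν)
    (fun j y => abs_rootError_le (hπ01 j) η σ ν _ _ _)
  rw [Fintype.card_fin] at haverage
  rw [← haverage]
  refine integral_congr_ae ?_
  filter_upwards [ae_all_iff.2 fun t =>
    ae_trajectoryLaw_eq_map hm hd hY hθ (hθY.mono fun ω hω => hω t)] with ω hω
  refine congrArg Real.sqrt (Finset.sum_congr rfl fun t _ => ?_)
  rw [hω t]
  exact integral_weightedError_map_trajectory hm hd (hπ (J ω)) ν _ _ _ t

end TrajectoryLaw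

end

theorem corollary1
    {Ω 𝒲 𝒵 : Type*} [MeasurableSpace Ω] [MeasurableSpace 𝒵]
    (μ : Measure Ω) [IsProbabilityMeasure μ]
    (PZ : Measure 𝒵) [IsProbabilityMeasure PZ]
    {N d T : ℕ} [NeZero N]
    -- the loss, bounded in `[a, b]`, and the hypotheses parametrized by `ℝ^d`
    (ℓ : 𝒲 → 𝒵 → ℝ) (hyp : Param d → 𝒲)
    (hℓ_meas : Measurable fun p : Param d × 𝒵 => ℓ (hyp p.1) p.2)
    (a b : ℝ) (hℓ_bdd : ∀ w z, ℓ w z ∈ Set.Icc a b)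
    (hℓ_diff : ∀ z, Differentiable ℝ fun x : Param d => ℓ (hyp x) z)
    (L : NNReal) (hℓ_lip : ∀ z, LipschitzWith L fun x : Param d => ℓ (hyp x) z)
    -- learning rates and noise levels
    (η σ : Fin T → ℝ) (hσ : ∀ t, 0 < σ t)
    -- random index, super-sample, Bernoulli bits, batches, parameters, Gaussian noise
    (J : Ω → Fin N) (S : Ω → SuperSample N 𝒵) (U : Ω → Fin N → Fin 2)
    (V : Ω → Fin T → Finset (Fin N)) (θ : Fin (T + 1) → Ω → Param d) (ε : Ω → Fin T → Param d)
    (hJ : Measurable J) (hS : Measurable S) (hU : Measurable U) (hV : Measurable V)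
    (hθ : ∀ t, Measurable (θ t)) (hε : Measurable ε)
    -- these are mutually independent, with the laws of the randomized subsample setting;
    -- the laws of the batch trajectory and of the initialization are arbitrary
    (hlaw : μ.map (fun ω => (J ω, S ω, U ω, V ω, θ 0 ω, ε ω)) =
      (PMF.uniformOfFintype (Fin N)).toMeasure.prod
        ((Measure.pi fun _ : Fin 2 × Fin N => PZ).prod
          ((Measure.pi fun _ : Fin N => (PMF.uniformOfFintype (Fin 2)).toMeasure).prod
            ((μ.map V).prod
              ((μ.map (θ 0)).prod
                (Measure.pi fun _ : Fin T => stdGaussian (Param d)))))))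
    -- the batches have constant size `K`
    (K : ℕ) (hK : 0 < K) (hcard : ∀ t, ∀ᵐ ω ∂μ, (V ω t).card = K)
    -- the iterations of the algorithm on the selected dataset
    (hstep : ∀ t : Fin T, ∀ᵐ ω ∂μ, θ t.succ ω =
      sgldStep ℓ hyp (dataset (S ω) (U ω)) (V ω t) (η t) (σ t) (θ t.castSucc ω) (ε ω t))
    -- any estimate in `[0, 1]` of the event `U_J = 1`, computed from the super-sample, the bits
    -- other than `U_J`, the batches and the past trajectory of the parameters
    (est : (j : Fin N) → (t : Fin T) → SuperSample N 𝒵 × ({i : Fin N // i ≠ j} → Fin 2) ×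
      (Fin T → Finset (Fin N)) × (Fin (t.val + 1) → Param d) → ℝ)
    (hest_meas : ∀ j t, Measurable (est j t))
    (hest : ∀ j t x, est j t x ∈ Set.Icc (0 : ℝ) 1) :
    ∫ ω, genError ℓ PZ (hyp (θ (Fin.last T) ω)) (dataset (S ω) (U ω)) ∂μ ≤
      2 * (L : ℝ) / (K : ℝ) * (b - a) *
        ∫ ω, Real.sqrt (∑ t ∈ itersWith (V ω) (J ω),
          ∫ h, (η t) ^ 2 / (σ t) ^ 2 *
              (((U ω (J ω)).val : ℝ) -
                est (J ω) t (S ω, bitsExcept (U ω) (J ω), V ω, h)) ^ 2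
            ∂(trajectoryLaw μ S U V θ t (U ω, S ω, batchesBefore (V ω) t))) ∂μ := by
  have : IsProbabilityMeasure (μ.map V) := Measure.isProbabilityMeasure_map hV.aemeasurable
  have : IsProbabilityMeasure (μ.map (θ 0)) := Measure.isProbabilityMeasure_map (hθ 0).aemeasurable
  let f (x : Param d) : 𝒵 → ℝ := ℓ (hyp x)
  let Y (ω : Ω) : RunData N 𝒵 d T := (S ω, U ω, V ω, θ 0 ω, ε ω)
  have hJY : MeasurePreserving (fun ω => (J ω, Y ω)) μ ((PMF.uniformOfFintype _).toMeasure.prod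
      (runLaw PZ N (μ.map V) (noiseLaw (μ.map (θ 0)) (stdGaussian (Param d)) T))) :=
    ⟨hJ.prodMk (hS.prodMk (hU.prodMk (hV.prodMk ((hθ 0).prodMk hε)))), hlaw⟩
  have hbatches : ∀ᵐ v ∂μ.map V, ∀ t, (v t).card = K :=
    (ae_map_iff hV.aemeasurable (Set.to_countable _).measurableSet).2 (ae_all_iff.2 hcard)
  have hrun : ∀ᵐ ω ∂μ, ∀ t : Fin (T + 1),
      (fun r : Fin (t.val + 1) => θ (r.castLE t.isLt) ω) = trajectory f η σ (Y ω) t :=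
    (ae_all_iff.2 hstep).mono fun ω hω => eq_trajectory (p := fun t => θ t ω) hω
  have hgen := integral_genError_eq_integral_runLaw hℓ_meas hℓ_diff
    (measurePreserving_snd.comp hJY) (hrun.mono fun ω hω => congrFun (hω (Fin.last T)) (Fin.last T))
  have hroot := integral_sqrt_sum_trajectoryLaw_eq hℓ_meas hℓ_diff hJY hθ
    (hrun.mono fun ω hω t => hω t.castSucc) hest_meas hest
  have hbound := integral_genError_le (PZ := PZ) (ν₀ := μ.map (θ 0)) hℓ_meas
    (fun x z => hℓ_bdd (hyp x) z) hℓ_diff hℓ_lip η hσ hest_meas hest hbatches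
  rw [← hroot] at hbound
  exact hgen.trans_le hbound
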